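/- Let $\mathbf{k}$ be an algebraically closed field of characteristic $0$, let $n\ge 2$, and let $X\subset \mathbb{P}^N_{\mathbf{k}}$ be a closed subscheme of pure dimension $n$ all of whose local rings are Cohen--Macaulay, with $H^i(\mathbb{P}^N,\mathcal{I}_{X,\mathbb{P}^N}(t))=0$ for all $t\in\mathbb{Z}$ and all $1\le i\le n-1$. Let $Y$ be an irreducible component of $X_{\mathrm{red}}$ (with its reduced structure). Say that $Y$ has multiplicity $1$ in $X$ if there is a non-empty open subset $U\subseteq Y$ with $\mathcal{O}_{X,x}=\mathcal{O}_{Y,x}$ for all $x\in U$, and that $Y$ has multiplicity $>1$ otherwise. Fix an integer $e>0$. For an integral divisor $C\in|\mathcal{O}_Y(e)|$ (the integral zero scheme in $Y$ of a nonzero section of $\mathcal{O}_Y(e)$) let $\mathcal{I}_{C,X}\subset\mathcal{O}_X$ be the ideal sheaf of $C$ in $X$ and $$\Sigma_C:=\{p\in Y \mid \mathcal{I}_{C,X}\text{ is not locally free at }p\}.$$ (i) Suppose that $Y$ has multiplicity $>1$ in $X$. Then $\Sigma_C=C$ as sets for every integral $C\in|\mathcal{O}_Y(e)|$, i.e. $\mathcal{I}_{C,X}$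 is locally free at no point of $C$ and is locally free at every point of $Y\setminus C$. For integral $C_1,C_2\in|\mathcal{O}_Y(e)|$ we have $\mathcal{I}_{C_1,X}\cong\mathcal{I}_{C_2,X}$ as $\mathcal{O}_X$-modules if and only if $C_1=C_2$. (ii) Suppose that $Y$ has multiplicity $1$ in $X$ and that $X$ is not integral. Let $F$ be the scheme-theoretic intersection of $Y$ with the union of the other components of $X$, counted with their multiplicities (that is, with the scheme-theoretic closure of $X\setminus Y$ in $X$). Then $F\neq\emptyset$, $F$ has pure dimension $n-1$, and for every integral $C\in|\mathcal{O}_Y(e)|$ we have $F\cap C\neq\emptyset$ and $\Sigma_C=(F\cap C)_{\mathrm{red}}$. (iii) For any integral $C_1,C_2\in|\mathcal{O}_Y(e)|$ with $\mathcal{I}_{C_1,X}\cong\mathcal{I}_{C_2,X}$ we have $\Sigma_{C_1}=\Sigma_{C_2}$. If $Y$ has multiplicity $>1$ in $X$, then conversely $\Sigma_{C_1}=\Sigma_{C_2}$ implies $\mathcal{I}_{C_1,X}\cong\mathcal{I}_{C_2,X}$. -/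

import Mathlib

open CategoryTheory AlgebraicGeometry TopologicalSpace Opposite

universe u

namespace ACM

noncomputable section

/-! ### Projective space, its coordinate charts and the twists of a sheaf of modules -/

attribute [local instance] MvPolynomial.gradedAlgebra

/-- Projective space `ℙ^N` over `k`, as `Proj k[X_0, …, X_N]`. -/
abbrev ProjSpace (k : Type u) [Field k] (N : ℕ) : Scheme.{u} :=
  Proj (MvPolynomial.homogeneousSubmodule (Fin (N + 1)) k)

/-- The standard open subset `X_j ≠ 0` of `ℙ^N`. -/
def coordOpen (k : Type u) [Field k] (N : ℕ) (j : Fin (N + 1)) : (ProjSpace k N).Opens :=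
  Proj.basicOpen (MvPolynomial.homogeneousSubmodule (Fin (N + 1)) k) (MvPolynomial.X j)

/-- The regular function `X_l / X_j` on the open subset `X_j ≠ 0` of `ℙ^N`. -/
def coordRatio (k : Type u) [Field k] (N : ℕ) (j l : Fin (N + 1)) :
    Γ(ProjSpace k N, coordOpen k N j) :=
  (Proj.awayToSection (MvPolynomial.homogeneousSubmodule (Fin (N + 1)) k)
    (MvPolynomial.X j)).hom
    (HomogeneousLocalization.Away.mk (MvPolynomial.homogeneousSubmodule (Fin (N + 1)) k)
      (d := 1) (MvPolynomial.isHomogeneous_X k j) 1 (MvPolynomial.X l)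
      (MvPolynomial.isHomogeneous_X k l))

variable {k : Type u} [Field k] {N : ℕ} {Z : Scheme.{u}}

/-- The preimage in `Z` of the standard open subset `X_j ≠ 0`. -/
def chart (f : Z ⟶ ProjSpace k N) (j : Fin (N + 1)) : Z.Opens :=
  f ⁻¹ᵁ coordOpen k N j

/-- The function `X_l / X_j` on the part of `Z` where `X_j ≠ 0`. -/
def ratio (f : Z ⟶ ProjSpace k N) (j l : Fin (N + 1)) : Γ(Z, chart f j) :=
  (f.app (coordOpen k N j)).hom (coordRatio k N j l)

/-- Restriction of sections of a sheaf of modules. -/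
def res (M : Z.Modules) {U V : Z.Opens} (h : V ≤ U) : Γ(M, U) →+ Γ(M, V) :=
  (M.presheaf.map (homOfLE h).op).hom

/-- The function `X_l / X_j` on an open subset on which `X_j ≠ 0`. -/
def ratioOn (f : Z ⟶ ProjSpace k N) (j l : Fin (N + 1)) {W : Z.Opens} (h : W ≤ chart f j) :
    Γ(Z, W) :=
  (Z.presheaf.map (homOfLE h).op).hom (ratio f j l)

/-- Sections over `U` of the twist `M(t) = M ⊗ 𝒪(t)`, where `𝒪(t)` is the pullback to `Z` of
`𝒪_{ℙ^N}(t)`. A section is written `s_j ⊗ X_j ^ t` on the part of `U` where `X_j ≠ 0`; such a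
family `(s_j)` is a section of `M(t)` when `s_j = (X_l / X_j) ^ t • s_l` on all overlaps. For
`t < 0` this relation is written `(X_l / X_j) ^ (-t) • s_j = s_l`. -/
def twistSections (f : Z ⟶ ProjSpace k N) (M : Z.Modules) (t : ℤ) (U : Z.Opens) :
    AddSubgroup (∀ j : Fin (N + 1), Γ(M, U ⊓ chart f j)) where
  carrier := {s | ∀ j l : Fin (N + 1),
    ratioOn f j l (W := U ⊓ (chart f j ⊓ chart f l)) (inf_le_right.trans inf_le_left)
        ^ t.toNat •
      res M (V := U ⊓ (chart f j ⊓ chart f l)) (inf_le_inf_left U inf_le_right) (s l) =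
    ratioOn f j l (W := U ⊓ (chart f j ⊓ chart f l)) (inf_le_right.trans inf_le_left)
        ^ (-t).toNat •
      res M (V := U ⊓ (chart f j ⊓ chart f l)) (inf_le_inf_left U inf_le_left) (s j)}
  zero_mem' := fun j l ↦ by simp
  add_mem' := fun {a b} ha hb j l ↦ by
    simp only [Pi.add_apply, map_add, smul_add]
    rw [ha j l, hb j l]
  neg_mem' := fun {a} ha j l ↦ by
    simp only [Pi.neg_apply, map_neg, smul_neg]
    rw [ha j l]

lemma res_res (M : Z.Modules) {U V W : Z.Opens} (h : V ≤ U) (h' : W ≤ V) (x : Γ(M, U)) :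
    res M h' (res M h x) = res M (h'.trans h) x := by
  have := M.presheaf.map_comp (homOfLE h).op (homOfLE h').op
  exact (ConcreteCategory.congr_hom this x).symm

lemma res_smul (M : Z.Modules) {U V : Z.Opens} (h : V ≤ U) (r : Γ(Z, U)) (x : Γ(M, U)) :
    res M h (r • x) = (Z.presheaf.map (homOfLE h).op).hom r • res M h x :=
  Scheme.Modules.map_smul M (homOfLE h) r x

lemma map_ratioOn (f : Z ⟶ ProjSpace k N) (j l : Fin (N + 1)) {V W : Z.Opens}
    (h : W ≤ chart f j) (h' : V ≤ W) :
    (Z.presheaf.map (homOfLE h').op).hom (ratioOn f j l h) = ratioOn f j l (h'.trans h) := by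
  have := Z.presheaf.map_comp (homOfLE h).op (homOfLE h').op
  exact (ConcreteCategory.congr_hom this (ratio f j l)).symm

/-- The two sides of the gluing relation, on an arbitrary open subset of the overlap. -/
lemma rel_res (f : Z ⟶ ProjSpace k N) (M : Z.Modules) (t : ℕ) {V W W' : Z.Opens}
    (j l : Fin (N + 1)) (hW : W ≤ chart f j) (hV : W ≤ V) (hW' : W' ≤ W) (x : Γ(M, V)) :
    res M hW' (ratioOn f j l hW ^ t • res M hV x) =
      ratioOn f j l (hW'.trans hW) ^ t • res M (hW'.trans hV) x := by
  rw [res_smul, map_pow, map_ratioOn, res_res]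

/-- Restriction maps of the twist. -/
def twistRes (f : Z ⟶ ProjSpace k N) (M : Z.Modules) (t : ℤ) {U V : Z.Opens} (h : V ≤ U) :
    twistSections f M t U →+ twistSections f M t V where
  toFun s := ⟨fun j ↦ res M (inf_le_inf_right _ h) (s.1 j), fun j l ↦ by
    have := congrArg (res M (V := V ⊓ (chart f j ⊓ chart f l)) (inf_le_inf_right _ h))
      (s.2 j l)
    rw [rel_res, rel_res] at this
    rw [res_res, res_res]
    exact this⟩
  map_zero' := by ext j; simp
  map_add' a b := by ext j; simp

/-- The presheaf of sections of the twist `M(t)`. -/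
def twistPresheaf (f : Z ⟶ ProjSpace k N) (M : Z.Modules) (t : ℤ) :
    TopCat.Presheaf Ab.{u} Z where
  obj U := AddCommGrpCat.of (twistSections f M t U.unop)
  map i := AddCommGrpCat.ofHom (twistRes f M t i.unop.le)
  map_id U := by
    ext s j
    exact ConcreteCategory.congr_hom (M.presheaf.map_id _) (s.1 j)
  map_comp {U V W} i i' := by
    ext s j
    exact (res_res M _ _ (s.1 j)).symm

lemma res_ext (M : Z.Modules) {ι : Type u} {U : Z.Opens} (V : ι → Z.Opens)
    (hV : ∀ i, V i ≤ U) (hU : U ≤ iSup V) {x y : Γ(M, U)}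
    (h : ∀ i, res M (hV i) x = res M (hV i) y) : x = y :=
  TopCat.Sheaf.eq_of_locally_eq' ⟨M.presheaf, M.isSheaf⟩ V U (fun i ↦ homOfLE (hV i)) hU x y h

lemma twistPresheaf_isSheaf (f : Z ⟶ ProjSpace k N) (M : Z.Modules) (t : ℤ) :
    (twistPresheaf f M t).IsSheaf := by
  rw [TopCat.Presheaf.isSheaf_iff_isSheafUniqueGluing]
  intro ι U sf hsf
  have hcov : ∀ W : Z.Opens, iSup U ⊓ W ≤ ⨆ i, U i ⊓ W := fun W ↦ by rw [iSup_inf_eq]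
  have hle : ∀ (W : Z.Opens) (i : ι), U i ⊓ W ≤ iSup U ⊓ W :=
    fun W i ↦ inf_le_inf_right _ (le_iSup U i)
  have key : ∀ j, ∃! s : Γ(M, iSup U ⊓ chart f j), ∀ i, res M (hle _ i) s = (sf i).1 j := by
    intro j
    refine TopCat.Sheaf.existsUnique_gluing' ⟨M.presheaf, M.isSheaf⟩ (fun i ↦ U i ⊓ chart f j)
      (iSup U ⊓ chart f j) (fun i ↦ homOfLE (hle _ i)) (hcov _) (fun i ↦ (sf i).1 j) ?_
    intro a b
    have h1 := congrArg (fun s ↦ s.1 j) (hsf a b)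
    have h2 := congrArg (res M (V := (U a ⊓ chart f j) ⊓ (U b ⊓ chart f j))
      (le_inf (le_inf (inf_le_left.trans inf_le_left) (inf_le_right.trans inf_le_left))
        (inf_le_left.trans inf_le_right))) h1
    exact (res_res M _ _ _).symm.trans (h2.trans (res_res M _ _ _))
  choose s hs hs' using key
  refine ⟨⟨s, fun j l ↦ ?_⟩, fun i ↦ Subtype.ext (funext fun j ↦ hs j i), ?_⟩
  · refine res_ext M (fun i ↦ U i ⊓ (chart f j ⊓ chart f l)) (hle _) (hcov _) fun i ↦ ?_
    rw [rel_res, rel_res]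
    have := (sf i).2 j l
    rw [← hs j i, ← hs l i, res_res, res_res] at this
    exact this
  · intro s' h'
    refine Subtype.ext (funext fun j ↦ hs' j _ fun i ↦ ?_)
    exact congrArg (fun s ↦ s.1 j) (h' i)

/-- The underlying sheaf of abelian groups of the twist `M(t) = M ⊗ 𝒪(t)`. -/
def twist (f : Z ⟶ ProjSpace k N) (M : Z.Modules) (t : ℤ) :
    Sheaf (Opens.grothendieckTopology Z) Ab.{u} :=
  ⟨twistPresheaf f M t, twistPresheaf_isSheaf f M t⟩

/-! ### Structure sheaf, ideal sheaves, local freeness -/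

/-- The structure sheaf as a module over itself. -/
def structureModule (Z : Scheme.{u}) : Z.Modules := SheafOfModules.unit Z.ringCatSheaf

/-- The morphism `𝒪_X ⟶ f_* 𝒪_Z`. -/
def unitToPushforward {X : Scheme.{u}} (f : Z ⟶ X) :
    structureModule X ⟶ (Scheme.Modules.pushforward f).obj (structureModule Z) :=
  SheafOfModules.unitToPushforwardObjUnit f.toRingCatSheafHom

/-- The ideal sheaf `I_{Z,X}` of a closed subscheme `f : Z ⟶ X`, as an `𝒪_X`-module: the kernel
of `𝒪_X ⟶ f_* 𝒪_Z`. -/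
def idealModule {X : Scheme.{u}} (f : Z ⟶ X) : X.Modules :=
  Limits.kernel (unitToPushforward f)

/-- `M` is locally free (of finite rank) at `p`: it is free on an open neighbourhood of `p`. -/
def IsLocallyFreeAt {X : Scheme.{u}} (M : X.Modules) (p : X) : Prop :=
  ∃ U : X.Opens, p ∈ U ∧ ∃ r : ℕ,
    Nonempty (M.restrict U.ι ≅
      (SheafOfModules.free (R := U.toScheme.ringCatSheaf) (ULift.{u} (Fin r)) :
        U.toScheme.Modules))

/-! ### Dimension, depth, arithmetically Cohen–Macaulay subschemes -/

/-- Every irreducible component of `T` has dimension `n`. -/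
def IsPureDim (T : Type u) [TopologicalSpace T] (n : ℕ) : Prop :=
  ∀ W ∈ irreducibleComponents T, topologicalKrullDim W = n

/-- The depth of a local ring: the supremum of the lengths of the regular sequences contained in
the maximal ideal. -/
def depth (R : Type u) [CommRing R] [IsLocalRing R] : ℕ∞ :=
  ⨆ rs : {rs : List R // (∀ r ∈ rs, r ∈ IsLocalRing.maximalIdeal R) ∧
    RingTheory.Sequence.IsRegular R rs}, (rs.1.length : ℕ∞)

/-- All local rings of `X` are Cohen–Macaulay. -/
def IsCohenMacaulay (X : Scheme.{u}) : Prop :=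
  ∀ x : X, ((depth (X.presheaf.stalk x) : ℕ∞) : WithBot ℕ∞) = ringKrullDim (X.presheaf.stalk x)

/-- The closed subscheme `f : X ⟶ ℙ^N` of dimension `n` satisfies `H^i(ℙ^N, I_X(t)) = 0` for all
`t ∈ ℤ` and `1 ≤ i ≤ n - 1`. -/
def HasACMVanishing {X : Scheme.{u}} (f : X ⟶ ProjSpace k N) (n : ℕ) : Prop :=
  ∀ (t : ℤ) (i : ℕ), 1 ≤ i → i ≤ n - 1 →
    Subsingleton ((twist (𝟙 (ProjSpace k N)) (idealModule f) t).H i)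

/-! ### Components, divisors, and the loci of the statement -/

section Component

variable {X : Scheme.{u}} (Y : Closeds X)

/-- The closed subset `Y` of `X` with its reduced structure. -/
abbrev reducedScheme : Scheme.{u} := (Scheme.IdealSheafData.vanishingIdeal Y).subscheme

/-- The inclusion of `Y`, with its reduced structure, in `X`. -/
abbrev reducedι : reducedScheme Y ⟶ X := (Scheme.IdealSheafData.vanishingIdeal Y).subschemeι

/-- `Y` has multiplicity one in `X`: `𝒪_{X,x} = 𝒪_{Y,x}` for all `x` in a non-empty open subset
of `Y`. -/
def HasMultiplicityOne : Prop :=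
  ∃ U : (reducedScheme Y).Opens, (∃ x, x ∈ U) ∧
    ∀ x ∈ U, Function.Bijective ((reducedι Y).stalkMap x).hom

/-- The scheme-theoretic intersection of `Y` with the union of the other components of `X`,
the latter taken with the structure that they have in `X`, that is, with the scheme-theoretic
closure of `X ∖ Y` in `X`. -/
def residualIntersection : X.IdealSheafData :=
  Scheme.IdealSheafData.vanishingIdeal Y ⊔ (Scheme.Opens.ι (X := X) Y.compl).ker

/-- The inclusion in `X` of a closed subscheme `C` of `Y`. -/
abbrev divisorι (C : (reducedScheme Y).IdealSheafData) : C.subscheme ⟶ X :=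
  C.subschemeι ≫ reducedι Y

/-- `Σ_C`, the set of points of `Y` at which the ideal sheaf `I_{C,X}` is not locally free. -/
def nonLocallyFreeLocus (C : (reducedScheme Y).IdealSheafData) : Set X :=
  {p | p ∈ Y ∧ ¬ IsLocallyFreeAt (idealModule (divisorι Y C)) p}

end Component

/-- `C` belongs to the complete linear system `|𝒪_Z(e)|`: it is the zero scheme of a nonzero
section `s` of `𝒪_Z(e)`, i.e. where `X_j ≠ 0` its ideal is generated by the function `s_j`
(with `s = s_j X_j ^ e`). The scheme `Z` is meant to be integral. -/
def MemLinearSystem (f : Z ⟶ ProjSpace k N) (e : ℤ) (C : Z.IdealSheafData) : Prop :=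
  ∃ s : twistSections f (structureModule Z) e ⊤, s ≠ 0 ∧
    ∀ (j : Fin (N + 1)) (V : Z.affineOpens) (h : V.1 ≤ ⊤ ⊓ chart f j),
      C.ideal V = Ideal.span {(Z.presheaf.map (homOfLE h).op).hom (s.1 j : Γ(Z, ⊤ ⊓ chart f j))}

end

end ACM

namespace ACM

/-! ### Dimension theory of finitely generated algebras over a field -/

section Dimension

/-! Everything rests on one local fact: `I_{C,X}` can be free at a point of `C` only if `X`
coincides with `Y` near that point. On a small affine neighbourhood let `P ⊆ I` be the ideals of `Y`
and of `C`. A nonzero free ideal is principal, say `I = (f)`, and `f ∉ P` because `C` is cut out on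
`Y` by a nonzero section. As `P` is prime, `P = fP`, so Nakayama gives `a ≡ 1` modulo `I` with `aP =
0`; since `a` is invertible along `C`, `P` vanishes near the point
(`exists_ideal_eq_bot_of_isLocallyFreeAt`). In multiplicity `> 1` this is impossible, so `Σ_C = C`.
An integral `C` is reduced, hence recovered from `Σ_C`; this gives (i) and the converse in (iii).

In multiplicity one, Cohen–Macaulayness excludes embedded components, so `X = Y` off the closure of
`X ∖ Y`, and there the section defining `C` is a nonzerodivisor generating `I_{C,X}`. Hence `Σ_C = F
∩ C` (`nonLocallyFreeLocus_eq`). Three facts about `F` remain.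

`F` is non-empty: `H^1(I_X) = 0` makes the functions on `X` a quotient of those on `ℙ^N`, which form
a field, so `X` is connected; and `Y ≠ X` as sets, since otherwise `X` would be integral.

`F` has pure codimension one in `Y`: at a generic point of `F` the punctured spectrum of the local
ring of `X` is disconnected, so by Hartshorne's theorem the depth, which is the dimension, is at
most one (`ringKrullDim_stalk_le_one`). The dimension theory of finitely generated domains turns
this into the dimension of the closure.

`F` meets `C`: on a component `W` of `F` missing `C` the section `u` of `𝒪(e)` vanishes nowhere, so
each `X_l ^ e / u` is a global function on `W`. These functions form a field, so `W` lies in one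
chart, is affine and has dimension zero; but `n - 1 ≥ 1`. -/

lemma MvPolynomial_height_eq_of_isMaximal {k : Type u} [Field k] {d : ℕ}
    (m : Ideal (MvPolynomial (Fin d) k)) [hm : m.IsMaximal] : m.height = d := by
  induction d with
  | zero =>
    have h : ringKrullDim (MvPolynomial (Fin 0) k) = 0 := by simp
    have := Ideal.height_le_ringKrullDim_of_ne_top hm.ne_top
    rw [h] at this
    simpa using this
  | succ d ih =>
    let e := (MvPolynomial.finSuccEquiv k d).toRingEquiv
    let P : Ideal (Polynomial (MvPolynomial (Fin d) k)) := m.map e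
    have : P.IsMaximal := Ideal.map_isMaximal_of_equiv e
    let p := P.comap (Polynomial.C : MvPolynomial (Fin d) k →+* _)
    -- A polynomial ring over a field is Jacobson, so maximal ideals contract to maximal ideals and
    -- the induction hypothesis applies to `p`.
    have hp : p.IsMaximal := Polynomial.isMaximal_comap_C_of_isJacobsonRing P
    have : P.LiesOver p := ⟨rfl⟩
    have h := Polynomial.height_eq_height_add_one p P
    rw [ih p, e.height_map] at h
    rw [h]; push_cast; rfl

variable {R S : Type u} [CommRing R] [CommRing S] [Algebra R S]

lemma ringKrullDim_le_of_isIntegral [Algebra.IsIntegral R S] :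
    ringKrullDim S ≤ ringKrullDim R :=
  Order.krullDim_le_of_strictMono (fun p ↦ PrimeSpectrum.comap (algebraMap R S) p)
    fun _ _ h ↦ Ideal.IsIntegral.comap_lt_comap (R := R) h

/-- Lying over provides a prime above the bottom of a chain, and going up lifts the rest of it. -/
lemma ringKrullDim_le_of_isIntegral_of_injective [Algebra.IsIntegral R S]
    (h : Function.Injective (algebraMap R S)) : ringKrullDim R ≤ ringKrullDim S := by
  refine iSup_le fun l ↦ ?_
  obtain ⟨Q, -, hQ, hQ'⟩ := Ideal.exists_ideal_over_prime_of_isIntegral (S := S)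
    (RelSeries.head l).asIdeal ⊥ (by
      intro x hx
      have : algebraMap R S x = 0 := hx
      rw [(injective_iff_map_eq_zero _).1 h x this]; exact zero_mem _)
  have : Q.LiesOver (RelSeries.head l).asIdeal := ⟨hQ'.symm⟩
  obtain ⟨L, hL, -⟩ := Ideal.exists_ltSeries_of_hasGoingUp l Q
  rw [← hL]
  exact le_iSup (fun L : LTSeries (PrimeSpectrum S) ↦ (L.length : WithBot ℕ∞)) L

/-- The Krull dimension of a finitely generated domain over a field is its transcendence degree. -/
lemma ringKrullDim_eq_trdeg (k B : Type u) [Field k] [CommRing B] [IsDomain B] [Algebra k B]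
    [Algebra.FiniteType k B] :
    ∃ d : ℕ, Algebra.trdeg k B = d ∧ ringKrullDim B = d := by
  obtain ⟨d, g, hg, hi⟩ := exists_integral_inj_algHom_of_fg k B
  algebraize [g.toRingHom]
  have hinj : Function.Injective (algebraMap (MvPolynomial (Fin d) k) B) := hg
  have : Algebra.IsIntegral (MvPolynomial (Fin d) k) B := ⟨hi⟩
  have : FaithfulSMul (MvPolynomial (Fin d) k) B :=
    (faithfulSMul_iff_algebraMap_injective _ _).2 hinj
  have : IsScalarTower k (MvPolynomial (Fin d) k) B :=
    .of_algebraMap_eq fun x ↦ (g.commutes x).symm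
  refine ⟨d, ?_, ?_⟩
  · rw [← trdeg_add_eq k (MvPolynomial (Fin d) k) (A := B)]
    simp [trdeg_eq_zero]
  · apply le_antisymm
    · exact (ringKrullDim_le_of_isIntegral (R := MvPolynomial (Fin d) k)).trans (by simp)
    · refine le_trans ?_ (ringKrullDim_le_of_isIntegral_of_injective hinj)
      simp

/-- Inverting a nonzero element is an algebraic extension that stays of finite type, so the
transcendence degree does not change. -/
lemma ringKrullDim_eq_of_isLocalization_away (k : Type u) {B B' : Type u} [Field k] [CommRing B]
    [IsDomain B] [Algebra k B] [Algebra.FiniteType k B] [CommRing B'] [Algebra k B'] [Algebra B B']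
    [IsScalarTower k B B'] (h : B) (hh : h ≠ 0) [IsLocalization.Away h B'] :
    ringKrullDim B' = ringKrullDim B := by
  have hM : Submonoid.powers h ≤ nonZeroDivisors B := powers_le_nonZeroDivisors_of_noZeroDivisors hh
  have : IsDomain B' := IsLocalization.isDomain_of_le_nonZeroDivisors B' hM
  have : Algebra.FiniteType B B' := IsLocalization.finiteType_of_monoid_fg (Submonoid.powers h) B'
  have : Algebra.FiniteType k B' := .trans (S := B) inferInstance inferInstance
  have : Algebra.IsAlgebraic B B' := IsLocalization.isAlgebraic _ (Submonoid.powers h)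
  have : FaithfulSMul B B' := (faithfulSMul_iff_algebraMap_injective _ _).2
    (IsLocalization.injective B' hM)
  obtain ⟨d, hd, hd'⟩ := ringKrullDim_eq_trdeg k B
  obtain ⟨e, he, he'⟩ := ringKrullDim_eq_trdeg k B'
  rw [← trdeg_add_eq k B (A := B')] at he
  rw [hd, trdeg_eq_zero, add_zero] at he
  rw [hd', he', Nat.cast_injective (R := Cardinal) he]

open Polynomial in
/-- If `g * b = c` with `c` in the integrally closed base ring, then the constant coefficient of
the minimal polynomial of `g` divides a power of `c`. -/
lemma minpoly_coeff_zero_dvd_pow [IsDomain R] [IsIntegrallyClosed R] [IsDomain S]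
    [Algebra.IsIntegral R S] [FaithfulSMul R S] {g b : S} {c : R}
    (h : g * b = algebraMap R S c) : ∃ r : ℕ, (minpoly R g).coeff 0 ∣ c ^ r := by
  by_cases hc : c = 0
  · exact ⟨1, by simp [hc]⟩
  have hinj := FaithfulSMul.algebraMap_injective R S
  have hb : b ≠ 0 := by
    rintro rfl
    rw [mul_zero, eq_comm, map_eq_zero_iff _ hinj] at h
    exact hc h
  -- the polynomial `Σ aᵢ cⁱ X^(n-i)` killing `y` when `Σ aᵢ Xⁱ` is the minimal polynomial of `x`
  let q : S → R[X] := fun x ↦ ∑ i ∈ Finset.range ((minpoly R x).natDegree + 1),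
    monomial ((minpoly R x).natDegree - i) ((minpoly R x).coeff i * c ^ i)
  have hdeg : ∀ x, (q x).natDegree ≤ (minpoly R x).natDegree := fun x ↦
    natDegree_sum_le_of_forall_le _ _ fun i _ ↦ (natDegree_monomial_le _).trans (Nat.sub_le _ _)
  have hcoeff : ∀ x, ∀ j ≤ (minpoly R x).natDegree, (q x).coeff ((minpoly R x).natDegree - j) =
      (minpoly R x).coeff j * c ^ j := by
    intro x j hj
    simp only [q, finsetSum_coeff, coeff_monomial]
    rw [Finset.sum_eq_single j]
    · simp
    · intro i hi hij
      rw [if_neg]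
      have := Finset.mem_range.1 hi
      omega
    · intro hj'
      exact absurd (Finset.mem_range.2 (by omega)) hj'
  have hint : ∀ x : S, IsIntegral R x := Algebra.IsIntegral.isIntegral
  have hq0 : ∀ x, (q x).coeff 0 = c ^ (minpoly R x).natDegree := by
    intro x
    have := hcoeff x _ le_rfl
    rwa [Nat.sub_self, (minpoly.monic (hint x)).coeff_natDegree, one_mul] at this
  have hqne : ∀ x, q x ≠ 0 := by
    intro x h0
    have := hq0 x
    rw [h0, coeff_zero] at this
    exact pow_ne_zero _ hc this.symm
  have hroot : ∀ x y, x * y = algebraMap R S c → aeval y (q x) = 0 := by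
    intro x y hxy
    have h1 := minpoly.aeval R x
    rw [aeval_eq_sum_range] at h1
    have : aeval y (q x) = y ^ (minpoly R x).natDegree * ∑ i ∈ Finset.range
        ((minpoly R x).natDegree + 1), (minpoly R x).coeff i • x ^ i := by
      simp only [q, map_sum, aeval_monomial, Finset.mul_sum]
      refine Finset.sum_congr rfl fun i hi ↦ ?_
      have hi' : i ≤ (minpoly R x).natDegree := by have := Finset.mem_range.1 hi; omega
      rw [map_mul, map_pow, ← hxy, mul_pow, Algebra.smul_def]
      calc _ = algebraMap R S ((minpoly R x).coeff i) * x ^ i *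
            (y ^ i * y ^ ((minpoly R x).natDegree - i)) := by ring
        _ = _ := by rw [← pow_add, Nat.add_sub_cancel' hi']; ring
    rw [this, h1, mul_zero]
  have hdvd : ∀ x y, x * y = algebraMap R S c → minpoly R y ∣ q x := fun x y hxy ↦
    minpoly.isIntegrallyClosed_dvd (hint y) (hroot x y hxy)
  have hle : ∀ x y, x * y = algebraMap R S c →
      (minpoly R y).natDegree ≤ (minpoly R x).natDegree := fun x y hxy ↦
    (natDegree_le_of_dvd (hdvd x y hxy) (hqne x)).trans (hdeg x)
  -- Exchanging the roles of `g` and `b` gives both degree inequalities, so `minpoly R b` divides `q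
  -- g` with a constant quotient.
  have hr : (minpoly R b).natDegree = (minpoly R g).natDegree :=
    le_antisymm (hle g b h) (hle b g (by rw [mul_comm]; exact h))
  obtain ⟨e, he⟩ := hdvd g b h
  have hene : e ≠ 0 := by
    rintro rfl
    exact hqne g (by rw [he, mul_zero])
  have hedeg : e.natDegree = 0 := by
    have h1 := hdeg g
    rw [he, (minpoly.monic (hint b)).natDegree_mul' hene, hr] at h1
    omega
  obtain ⟨e₀, rfl⟩ := natDegree_eq_zero.1 hedeg
  refine ⟨(minpoly R g).natDegree, (minpoly R b).coeff 0, ?_⟩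
  -- The coefficients of top degree identify the constant `e₀` with `(minpoly R g).coeff 0`; the
  -- constant coefficients then write a power of `c` as the product of the two constant terms.
  have h0 := hcoeff g 0 (Nat.zero_le _)
  rw [Nat.sub_zero, pow_zero, mul_one, he, coeff_mul_C, ← hr,
    (minpoly.monic (hint b)).coeff_natDegree, one_mul] at h0
  rw [← hq0, he, coeff_mul_C, h0, mul_comm]

open Polynomial in
lemma algebraMap_minpoly_coeff_zero_mem_span (g : S) :
    algebraMap R S ((minpoly R g).coeff 0) ∈ Ideal.span {g} := by
  have h := minpoly.aeval R g
  rw [← divX_mul_X_add (minpoly R g)] at h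
  simp only [map_add, map_mul, aeval_X, aeval_C] at h
  rw [Ideal.mem_span_singleton, eq_neg_of_add_eq_zero_right h]
  exact (Dvd.intro_left _ rfl).neg_right

/-- A prime ideal of height at most one in a finitely generated domain over a field has
codimension at most one. -/
lemma ringKrullDim_le_ringKrullDim_quotient_add_one (k : Type u) {B : Type u} [Field k] [CommRing B]
    [IsDomain B] [Algebra k B] [Algebra.FiniteType k B] (p : Ideal B) [hp : p.IsPrime]
    (hht : p.height ≤ 1) : ringKrullDim B ≤ ringKrullDim (B ⧸ p) + 1 := by
  by_cases hp0 : p = ⊥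
  · subst hp0
    rw [ringKrullDim_eq_of_ringEquiv (RingEquiv.quotientBot B)]
    exact le_add_of_nonneg_right zero_le_one
  have : IsNoetherianRing B := Algebra.FiniteType.isNoetherianRing k B
  obtain ⟨g, hgp, hg0⟩ := Submodule.exists_mem_ne_zero_of_ne_bot hp0
  -- Since `p` has height at most one and `g ≠ 0`, `p` is a minimal prime of `(g)`.
  have hmin : ∀ q : Ideal B, q.IsPrime → g ∈ q → q ≤ p → q = p := by
    intro q hq hgq hqp
    by_contra hne
    have h1 := Ideal.height_strict_mono_of_isPrime_of_isPrime (lt_of_le_of_ne hqp hne)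
    have h2 : q.height ≠ 0 := fun h ↦ by
      rw [Ideal.height_eq_zero_iff_eq_bot] at h
      subst h
      exact hg0 (by simpa using hgq)
    exact h2 (Order.lt_one_iff.1 (h1.trans_le hht))
  -- The element `h` is a product over the other minimal primes of `(g)`, one factor from each,
  -- chosen outside `p`. After inverting `h`, the prime `p` becomes the radical of `(g)`.
  obtain ⟨h, hhp, hh⟩ : ∃ h ∉ p, ∀ a ∈ p, a * h ∈ (Ideal.span {g}).radical := by
    have hfin := (Ideal.span {g}).finite_minimalPrimes_of_isNoetherianRing B
    have : ∀ Q : Ideal B, ∃ x ∉ p, Q ∈ (Ideal.span {g}).minimalPrimes → Q ≠ p → x ∈ Q := by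
      intro Q
      by_cases hQ : Q ∈ (Ideal.span {g}).minimalPrimes ∧ Q ≠ p
      · have : ¬ Q ≤ p := fun hle ↦ hQ.2 (hmin Q hQ.1.1.1
          (hQ.1.1.2 (Ideal.mem_span_singleton_self g)) hle)
        obtain ⟨x, hx, hx'⟩ := SetLike.not_le_iff_exists.1 this
        exact ⟨x, hx', fun _ _ ↦ hx⟩
      · exact ⟨1, (Ideal.ne_top_iff_one p).1 hp.ne_top, fun h1 h2 ↦ absurd ⟨h1, h2⟩ hQ⟩
    choose x hx hx' using this
    refine ⟨∏ Q ∈ hfin.toFinset, x Q, ?_, ?_⟩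
    · rw [Ideal.IsPrime.prod_mem_iff]
      push Not
      exact fun Q _ ↦ hx Q
    · intro a ha
      rw [← Ideal.sInf_minimalPrimes, Submodule.mem_sInf]
      intro Q hQ
      by_cases hQp : Q = p
      · exact Ideal.mul_mem_right _ _ (hQp ▸ ha)
      · exact Ideal.mul_mem_left _ _ (Ideal.mem_of_dvd _
          (Finset.dvd_prod_of_mem x (hfin.mem_toFinset.2 hQ)) (hx' Q hQ hQp))
  have hh0 : h ≠ 0 := fun h0 ↦ hhp (h0 ▸ zero_mem p)
  let B' := Localization.Away h
  have hM : Submonoid.powers h ≤ nonZeroDivisors B := powers_le_nonZeroDivisors_of_noZeroDivisors hh0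
  have : IsDomain B' := IsLocalization.isDomain_of_le_nonZeroDivisors B' hM
  have hBB' : Function.Injective (algebraMap B B') := IsLocalization.injective B' hM
  have : Algebra.FiniteType B B' := IsLocalization.finiteType_of_monoid_fg (Submonoid.powers h) B'
  have : Algebra.FiniteType k B' := .trans (S := B) inferInstance inferInstance
  have hdisj : Disjoint (Submonoid.powers h : Set B) (p : Set B) := by
    rw [Set.disjoint_left]
    rintro _ ⟨n, rfl⟩ hn
    exact hhp (hp.mem_of_pow_mem n hn)
  let p' : Ideal B' := p.map (algebraMap B B')
  have hp' : p'.IsPrime := IsLocalization.isPrime_of_isPrime_disjoint (Submonoid.powers h) B' p hp hdisj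
  have hp'c : p'.comap (algebraMap B B') = p :=
    IsLocalization.under_map_of_isPrime_disjoint (Submonoid.powers h) B' hp hdisj
  have hrad : ∀ y ∈ p', ∃ n : ℕ, y ^ n ∈ Ideal.span {algebraMap B B' g} := by
    intro y hy
    obtain ⟨⟨⟨a, ha⟩, s⟩, hs⟩ := (IsLocalization.mem_map_algebraMap_iff (Submonoid.powers h) B').1 hy
    obtain ⟨n, hn⟩ := hh a ha
    refine ⟨n, ?_⟩
    have h1 : algebraMap B B' ((a * h) ^ n) ∈ Ideal.span {algebraMap B B' g} := by
      rw [← Set.image_singleton, ← Ideal.map_span]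
      exact Ideal.mem_map_of_mem _ hn
    have hu : IsUnit (algebraMap B B' s * algebraMap B B' h) :=
      (IsLocalization.map_units B' s).mul (IsLocalization.Away.algebraMap_isUnit h)
    rw [map_pow, map_mul] at h1
    simp only at hs
    rw [← hs, mul_assoc, mul_pow] at h1
    exact (Ideal.mul_unit_mem_iff_mem _ (hu.pow n)).1 h1
  obtain ⟨d, f, hf, hi⟩ := exists_integral_inj_algHom_of_fg k B'
  let A := MvPolynomial (Fin d) k
  algebraize [f.toRingHom]
  have hinj : Function.Injective (algebraMap A B') := hf
  have : Algebra.IsIntegral A B' := ⟨hi⟩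
  have : FaithfulSMul A B' := (faithfulSMul_iff_algebraMap_injective _ _).2 hinj
  have hg' : algebraMap B B' g ≠ 0 := fun h0 ↦ hg0 ((map_eq_zero_iff _ hBB').1 h0)
  -- The constant coefficient `a` plays the role of the norm of `g` down to the Noether
  -- normalization `A`: the contraction `q` of `p'` is the radical of `(a)`. Krull's theorem in `A`,
  -- whose maximal ideals all have height `d`, then bounds `d` by `dim A/q + 1`.
  let q : Ideal A := p'.comap (algebraMap A B')
  let a : A := (minpoly A (algebraMap B B' g)).coeff 0
  have haq : a ∈ q := by
    have := algebraMap_minpoly_coeff_zero_mem_span (R := A) (algebraMap B B' g)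
    exact (Ideal.span_singleton_le_iff_mem _).2 (Ideal.mem_map_of_mem _ hgp) this
  have hqa : ∀ c ∈ q, ∃ n : ℕ, a ∣ c ^ n := by
    intro c hc
    obtain ⟨n, hn⟩ := hrad _ hc
    rw [← map_pow, Ideal.mem_span_singleton] at hn
    obtain ⟨b, hb⟩ := hn
    obtain ⟨r, hr⟩ := minpoly_coeff_zero_dvd_pow hb.symm
    exact ⟨n * r, by rwa [pow_mul]⟩
  have hq : q.IsPrime := Ideal.comap_isPrime _ _
  obtain ⟨m, hm, hqm⟩ := Ideal.exists_le_maximal q hq.ne_top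
  have hd : ringKrullDim B = d := by
    rw [← ringKrullDim_eq_of_isLocalization_away k (B' := B') h hh0]
    apply le_antisymm
    · exact (ringKrullDim_le_of_isIntegral (R := A)).trans (by simp [A])
    · refine le_trans ?_ (ringKrullDim_le_of_isIntegral_of_injective hinj)
      simp [A]
  have h1 := Ideal.height_le_ringKrullDim_quotient_add_one (hqm haq)
  rw [MvPolynomial_height_eq_of_isMaximal] at h1
  have h2 : ringKrullDim (A ⧸ Ideal.span {a}) ≤ ringKrullDim (A ⧸ q) := by
    rw [ringKrullDim_quotient, ringKrullDim_quotient]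
    refine Order.krullDim_le_of_strictMono (fun x ↦ ⟨x.1, fun c hc ↦ ?_⟩) fun _ _ h ↦ h
    obtain ⟨n, hn⟩ := hqa c hc
    have hx : a ∈ x.1.asIdeal := x.2 (Ideal.mem_span_singleton_self a)
    exact x.1.2.mem_of_pow_mem n (Ideal.mem_of_dvd _ hn hx)
  have h3 : ringKrullDim (A ⧸ q) ≤ ringKrullDim (B' ⧸ p') := by
    have : Algebra.IsIntegral (A ⧸ q) (B' ⧸ p') :=
      inferInstanceAs (Algebra.IsIntegral (A ⧸ p'.comap (algebraMap A B')) (B' ⧸ p'))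
    exact ringKrullDim_le_of_isIntegral_of_injective (R := A ⧸ q) (S := B' ⧸ p')
      Ideal.algebraMap_quotient_injective
  have h4 : ringKrullDim (B' ⧸ p') ≤ ringKrullDim (B ⧸ p) := by
    rw [ringKrullDim_quotient, ringKrullDim_quotient]
    refine Order.krullDim_le_of_strictMono
      (fun x ↦ ⟨PrimeSpectrum.comap (algebraMap B B') x.1, fun c hc ↦ ?_⟩) fun x y hxy ↦ ?_
    · exact x.2 (Ideal.mem_map_of_mem _ hc)
    · exact lt_iff_le_not_ge.2 ⟨Ideal.comap_mono hxy.le, fun h' ↦ hxy.not_ge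
        ((IsLocalization.orderEmbedding (Submonoid.powers h) B').le_iff_le.1 h')⟩
  rw [hd]
  calc (d : WithBot ℕ∞) ≤ _ := by exact_mod_cast h1
    _ ≤ _ := by gcongr; exact h2.trans (h3.trans h4)

end Dimension

end ACM

namespace ACM

/-! ### Depth -/

section Depth

variable {R : Type u} [CommRing R] [IsLocalRing R]

lemma depth_eq_zero_of_annihilator {b : R} (hb : b ≠ 0)
    (h : ∀ r ∈ IsLocalRing.maximalIdeal R, r * b = 0) : depth R = 0 := by
  refine le_antisymm (iSup_le ?_) bot_le
  rintro ⟨rs, hrs, hreg⟩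
  cases rs with
  | nil => simp
  | cons r rs =>
    exfalso
    have := ((RingTheory.Sequence.isWeaklyRegular_cons_iff R r rs).1 hreg.toIsWeaklyRegular).1
    exact hb (this (by simpa using h r (hrs r (by simp))))

open Pointwise in
lemma exists_regular_pair_of_two_le_depth (h : 2 ≤ depth R) :
    ∃ t ∈ IsLocalRing.maximalIdeal R, ∃ s ∈ IsLocalRing.maximalIdeal R,
      (∀ x, t * x = 0 → x = 0) ∧ ∀ x y, s * x = t * y → ∃ z, x = t * z := by
  have h1 : 1 < depth R := lt_of_lt_of_le (by norm_num) h
  obtain ⟨⟨rs, hrs, hreg⟩, hlen⟩ := lt_iSup_iff.1 h1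
  simp only at hlen
  match rs, hrs, hreg, hlen with
  | [], _, _, hlen => simp at hlen
  | [_], _, _, hlen => simp at hlen
  | t :: s :: rs, hrs, hreg, _ =>
    have hw := (RingTheory.Sequence.isWeaklyRegular_cons_iff R t (s :: rs)).1 hreg.toIsWeaklyRegular
    have hw' := ((RingTheory.Sequence.isWeaklyRegular_cons_iff _ s rs).1 hw.2).1
    refine ⟨t, hrs t (by simp), s, hrs s (by simp), fun x hx ↦ hw.1 (by simpa using hx), ?_⟩
    intro x y hxy
    have : Submodule.Quotient.mk (p := t • (⊤ : Submodule R R)) x = 0 := by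
      apply hw'
      simp only [smul_zero]
      rw [← Submodule.Quotient.mk_smul, Submodule.Quotient.mk_eq_zero, smul_eq_mul, hxy]
      exact Submodule.smul_mem_pointwise_smul _ _ _ trivial
    rw [Submodule.Quotient.mk_eq_zero] at this
    obtain ⟨z, -, hz⟩ := this
    exact ⟨z, hz.symm⟩

/-- Hartshorne's connectedness theorem, in algebraic form. -/
lemma eq_bot_or_eq_bot_of_two_le_depth (h : 2 ≤ depth R) {I J : Ideal R}
    (hIJ : ∀ i ∈ I, ∀ j ∈ J, i * j = 0)
    (hrad : IsLocalRing.maximalIdeal R ≤ (I ⊔ J).radical) : I = ⊥ ∨ J = ⊥ := by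
  obtain ⟨t, ht, s, hs, hreg, hreg'⟩ := exists_regular_pair_of_two_le_depth h
  obtain ⟨n, hn⟩ := hrad ht
  obtain ⟨m, hm⟩ := hrad hs
  obtain ⟨i, hi, j, hj, hij⟩ := Submodule.mem_sup.1 hn
  obtain ⟨i', hi', j', hj', hij'⟩ := Submodule.mem_sup.1 hm
  have hregn : ∀ n x, t ^ n * x = 0 → x = 0 := by
    intro n
    induction n with
    | zero => simp
    | succ n ih => exact fun x hx ↦ ih x (hreg _ (by rw [← mul_assoc, ← pow_succ']; exact hx))
  have hsm : ∀ m x y, s ^ m * x = t * y → ∃ z, x = t * z := by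
    intro m
    induction m with
    | zero => exact fun x y hxy ↦ ⟨y, by simpa using hxy⟩
    | succ m ih =>
      intro x y hxy
      obtain ⟨z, hz⟩ := hreg' (s ^ m * x) y (by rw [← hxy]; ring)
      exact ih x z hz
  have hsmn : ∀ n x y, s ^ m * x = t ^ n * y → ∃ z, x = t ^ n * z := by
    intro n
    induction n with
    | zero => exact fun x y _ ↦ ⟨x, by simp⟩
    | succ n ih =>
      intro x y hxy
      obtain ⟨z, rfl⟩ := hsm m x (t ^ n * y) (by rw [hxy]; ring)
      obtain ⟨w, rfl⟩ := ih z y (by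
        have := hreg (s ^ m * z - t ^ n * y) (by linear_combination hxy)
        exact sub_eq_zero.1 this)
      exact ⟨w, by ring⟩
  -- Both sides equal `i * i'`, because the mixed products vanish.
  have h1 : s ^ m * i = t ^ n * i' := by
    rw [← hij, ← hij', add_mul, add_mul]
    have e1 := hIJ i hi j' hj'
    have e2 := hIJ i' hi' j hj
    linear_combination e1 - e2
  obtain ⟨e, rfl⟩ := hsmn n i i' h1
  -- From `t ^ n = i + j` and `i = t ^ n * e` one gets `j = t ^ n * (1 - e)`, so `i * j = 0` makes
  -- `e` idempotent. In a local ring `e` is `1` or `0`; then `t ^ n` lies in `I` or in `J`, and,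
  -- being a nonzerodivisor, forces the other ideal to vanish.
  have hee : e * (1 - e) = 0 := by
    refine hregn n _ (hregn n _ ?_)
    have := hIJ _ hi j hj
    rw [show j = t ^ n * (1 - e) by linear_combination hij] at this
    linear_combination this
  have key : ∀ {I J : Ideal R}, (∀ i ∈ I, ∀ j ∈ J, i * j = 0) → t ^ n ∈ I → J = ⊥ := by
    intro I J hIJ htI
    rw [eq_bot_iff]
    exact fun x hx ↦ hregn n x (hIJ _ htI x hx)
  rcases IsLocalRing.isUnit_or_isUnit_one_sub_self e with hu | hu
  · refine Or.inr (key hIJ ?_)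
    have : 1 - e = 0 := by simpa [hu.mul_right_eq_zero] using hee
    rwa [← sub_eq_zero.1 this, mul_one] at hi
  · refine Or.inl (key (I := J) (fun i hi j hj ↦ by rw [mul_comm]; exact hIJ j hj i hi) ?_)
    have : e = 0 := by simpa [hu.mul_left_eq_zero] using hee
    rw [this] at hij
    rw [← hij, mul_zero, zero_add]
    exact hj

/-- Hartshorne's connectedness theorem: the punctured spectrum of a noetherian local ring of depth
at least two is connected. -/
lemma eq_univ_or_eq_univ_of_two_le_depth [IsNoetherianRing R] (h : 2 ≤ depth R)
    {S T : Set (PrimeSpectrum R)} (hS : IsClosed S) (hT : IsClosed T) (hST : S ∪ T = Set.univ)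
    (hST' : S ∩ T ⊆ {IsLocalRing.closedPoint R}) : S = Set.univ ∨ T = Set.univ := by
  obtain ⟨I, rfl⟩ := (PrimeSpectrum.isClosed_iff_zeroLocus_ideal S).1 hS
  obtain ⟨J, rfl⟩ := (PrimeSpectrum.isClosed_iff_zeroLocus_ideal T).1 hT
  rw [← PrimeSpectrum.zeroLocus_mul, PrimeSpectrum.zeroLocus_eq_univ_iff] at hST
  -- The product `I * J` is only nilpotent; passing to `n`-th powers makes it zero without changing
  -- the zero loci.
  obtain ⟨n, hn⟩ := IsNoetherianRing.isNilpotent_nilradical R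
  have hn' : I ^ n * J ^ n = ⊥ := by
    rw [← mul_pow, eq_bot_iff, ← Ideal.zero_eq_bot, ← hn]
    exact Ideal.pow_right_mono (fun x hx ↦ hST hx) n
  have hrad : IsLocalRing.maximalIdeal R ≤ (I ^ n ⊔ J ^ n).radical := by
    rw [Ideal.radical_eq_sInf]
    refine le_sInf fun Q ⟨hQ, hQ'⟩ ↦ ?_
    have : (⟨Q, hQ'⟩ : PrimeSpectrum R) ∈
        PrimeSpectrum.zeroLocus (I : Set R) ∩ PrimeSpectrum.zeroLocus J :=
      ⟨hQ'.le_of_pow_le (le_sup_left.trans hQ), hQ'.le_of_pow_le (le_sup_right.trans hQ)⟩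
    exact (congrArg PrimeSpectrum.asIdeal (hST' this)).ge
  have key : ∀ I : Ideal R, I ^ n = ⊥ → PrimeSpectrum.zeroLocus (I : Set R) = Set.univ :=
    fun I hI ↦ Set.eq_univ_of_forall fun x ↦ x.2.le_of_pow_le (hI ▸ bot_le)
  exact (eq_bot_or_eq_bot_of_two_le_depth h (fun i hi j hj ↦ by
    simpa [hn'] using Ideal.mul_mem_mul hi hj) hrad).imp (key I) (key J)

end Depth

/-! ### Free ideals -/

section FreeIdeal

variable {A : Type u} [CommRing A]

/-- A nonzero ideal that is a free module of finite rank is generated by one element. -/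
lemma exists_eq_span_singleton_of_linearEquiv {r : ℕ} (I : Ideal A) (hI : I ≠ ⊥)
    (e : (Fin r → A) ≃ₗ[A] I) : ∃ f, I = Ideal.span {f} := by
  have : Nontrivial A := by
    by_contra h
    rw [not_nontrivial_iff_subsingleton] at h
    exact hI (Subsingleton.elim _ _)
  match r, e with
  | 0, e =>
    exfalso
    apply hI
    rw [eq_bot_iff]
    intro x hx
    have : (⟨x, hx⟩ : I) = 0 := e.symm.injective (Subsingleton.elim _ _)
    simpa using this
  | 1, e =>
    refine ⟨e (fun _ ↦ 1), le_antisymm (fun x hx ↦ ?_) ?_⟩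
    · rw [Ideal.mem_span_singleton]
      refine ⟨e.symm ⟨x, hx⟩ 0, ?_⟩
      have : e.symm ⟨x, hx⟩ = e.symm ⟨x, hx⟩ 0 • (fun _ ↦ 1) := by
        ext i; simp [Subsingleton.elim i 0]
      have h2 := congrArg e this
      rw [map_smul, LinearEquiv.apply_symm_apply] at h2
      have h3 := congrArg Subtype.val h2
      simpa [mul_comm] using h3
    · rw [Ideal.span_singleton_le_iff_mem]; exact (e _).2
  | r + 2, e =>
    exfalso
    -- Rank two or more is impossible: any two elements `e x`, `e y` of an ideal satisfy the
    -- relation `e y • x = e x • y`, against the independence of basis vectors.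
    let x : Fin (r + 2) → A := Pi.single 0 1
    let y : Fin (r + 2) → A := Pi.single 1 1
    have h : (e y : A) • x = (e x : A) • y := by
      apply e.injective
      rw [map_smul, map_smul]
      ext
      simp [mul_comm]
    have h0 := congrFun h 0
    simp [x, y] at h0

/-- If a prime ideal `P` is strictly contained in a principal ideal `I`, it is killed by an
element congruent to `1` modulo `I`. -/
lemma exists_smul_eq_zero_of_lt_span_singleton (P I : Ideal A) [hP : P.IsPrime] (hfg : P.FG)
    {f : A} (hI : I = Ideal.span {f}) (hPI : P ≤ I) (hne : ¬ I ≤ P) :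
    ∃ a, a - 1 ∈ I ∧ ∀ x ∈ P, a * x = 0 := by
  have hf : f ∉ P := fun h ↦ hne (by rw [hI, Ideal.span_singleton_le_iff_mem]; exact h)
  refine Submodule.exists_sub_one_mem_and_smul_eq_zero_of_fg_of_le_smul I P hfg fun x hx ↦ ?_
  have := hPI hx
  rw [hI, Ideal.mem_span_singleton] at this
  obtain ⟨y, rfl⟩ := this
  have hy : y ∈ P := (hP.mem_or_mem hx).resolve_left hf
  exact Submodule.smul_mem_smul (hI ▸ Ideal.mem_span_singleton_self f) hy

end FreeIdeal

end ACM

namespace ACM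

/-! ### Dimension of schemes -/

section TopDim

variable {T : Type u} [TopologicalSpace T]

/-- A chain of irreducible closed sets keeps its length on an open neighbourhood of any point of its
smallest member. -/
lemma topologicalKrullDim_le_of_forall_exists_open {D : WithBot ℕ∞}
    (h : ∀ z : T, ∃ U : Opens T, z ∈ U ∧ topologicalKrullDim U ≤ D) : topologicalKrullDim T ≤ D := by
  refine iSup_le fun l ↦ ?_
  obtain ⟨z, hz⟩ := (RelSeries.head l).isIrreducible.nonempty
  obtain ⟨U, hzU, hU⟩ := h z
  let e := IrreducibleCloseds.orderIsoOfIsOpenEmbedding _ U.isOpenEmbedding'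
  refine le_trans ?_ hU
  rw [topologicalKrullDim, Order.krullDim_eq_of_orderIso e]
  have hmem (i) : (Subtype.val ⁻¹' (l i : Set T) : Set U).Nonempty :=
    ⟨⟨z, hzU⟩, (LTSeries.monotone l (Fin.zero_le i) : l 0 ≤ l i) hz⟩
  let l' : LTSeries {V : IrreducibleCloseds T // (Subtype.val ⁻¹' (V : Set T) : Set U).Nonempty} :=
    { length := l.length
      toFun := fun i ↦ ⟨l i, hmem i⟩
      step := fun i ↦ l.step i }
  exact le_iSup (fun L : LTSeries {V : IrreducibleCloseds T //
    (Subtype.val ⁻¹' (V : Set T) : Set U).Nonempty} ↦ (L.length : WithBot ℕ∞)) l'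

/-- The closures in `T` of a chain in `W` stay inside `W`, so `T` itself can be appended on top. -/
lemma topologicalKrullDim_add_one_le [IrreducibleSpace T] {W : Set T} (hW : IsClosed W)
    (hne : W ≠ Set.univ) : topologicalKrullDim W + 1 ≤ topologicalKrullDim T := by
  by_cases hemp : Nonempty (IrreducibleCloseds W)
  swap
  · rw [not_nonempty_iff] at hemp
    rw [topologicalKrullDim, Order.krullDim_eq_bot]
    simp
  rw [topologicalKrullDim, Order.krullDim_eq_iSup_length, ← WithBot.coe_one, ← WithBot.coe_add,
    ENat.iSup_add]
  have : Nonempty (IrreducibleCloseds T) :=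
    ⟨⟨Set.univ, IrreducibleSpace.isIrreducible_univ T, isClosed_univ⟩⟩
  rw [topologicalKrullDim, Order.krullDim_eq_iSup_length, WithBot.coe_le_coe]
  refine iSup_le fun l ↦ ?_
  let l' := l.map _ (IrreducibleCloseds.map_strictMono_of_isInducing
    (Topology.IsInducing.subtypeVal (t := W)))
  let t : IrreducibleCloseds T := ⟨Set.univ, IrreducibleSpace.isIrreducible_univ T, isClosed_univ⟩
  have hlt : RelSeries.last l' < t := by
    refine lt_of_le_of_ne (Set.subset_univ _) fun h ↦ hne ?_
    have h1 : ((RelSeries.last l' : IrreducibleCloseds T) : Set T) = Set.univ :=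
      congrArg (fun s : IrreducibleCloseds T ↦ (s : Set T)) h
    rw [← Set.univ_subset_iff, ← h1]
    refine closure_minimal ?_ hW
    rintro _ ⟨x, -, rfl⟩
    exact x.2
  exact le_iSup (fun L : LTSeries (IrreducibleCloseds T) ↦ (L.length : ℕ∞)) (l'.snoc t hlt)

end TopDim

section SchemeDim

variable {k : Type u} [Field k] {Y : Scheme.{u}}

lemma topologicalKrullDim_eq_ringKrullDim {V : Y.Opens} (hV : IsAffineOpen V) :
    topologicalKrullDim V = ringKrullDim Γ(Y, V) := by
  rw [← PrimeSpectrum.topologicalKrullDim_eq_ringKrullDim]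
  exact IsHomeomorph.topologicalKrullDim_eq _ hV.isoSpec.hom.homeomorph.isHomeomorph

lemma ringKrullDim_le_of_affineOpens_le {V W : Y.Opens} (hV : IsAffineOpen V) (hW : IsAffineOpen W)
    (h : W ≤ V) : ringKrullDim Γ(Y, W) ≤ ringKrullDim Γ(Y, V) := by
  rw [← topologicalKrullDim_eq_ringKrullDim hV, ← topologicalKrullDim_eq_ringKrullDim hW]
  exact (Topology.IsEmbedding.inclusion h).isInducing.topologicalKrullDim_le

lemma le_preimage_top {Z : Scheme.{u}} (f : Y ⟶ Z) (V : Y.Opens) : V ≤ f ⁻¹ᵁ ⊤ := le_top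

/-- The structure of a `k`-algebra on the sections of a scheme over `k`. -/
noncomputable abbrev sectionsAlgebra (f : Y ⟶ Spec (.of k)) (V : Y.Opens) : Algebra k Γ(Y, V) :=
  ((Scheme.ΓSpecIso (.of k)).inv ≫ f.appLE ⊤ V (le_preimage_top f V)).hom.toAlgebra

lemma finiteType_sections (f : Y ⟶ Spec (.of k)) [LocallyOfFiniteType f] {V : Y.Opens}
    (hV : IsAffineOpen V) : letI := sectionsAlgebra f V; Algebra.FiniteType k Γ(Y, V) := by
  let := sectionsAlgebra f V
  have h := f.finiteType_appLE (isAffineOpen_top _) hV (le_preimage_top f V)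
  exact h.comp (.of_surjective _
    (Scheme.ΓSpecIso (.of k)).symm.commRingCatIsoToRingEquiv.surjective)

/-- By irreducibility `V` and `W` meet; a non-empty basic open subset of `V` inside `W` has the
dimension of `V` and at most that of `W`. -/
lemma ringKrullDim_sections_le [IsIntegral Y] (f : Y ⟶ Spec (.of k)) [LocallyOfFiniteType f]
    {V W : Y.Opens} (hV : IsAffineOpen V) (hW : IsAffineOpen W) [Nonempty V] [Nonempty W] :
    ringKrullDim Γ(Y, V) ≤ ringKrullDim Γ(Y, W) := by
  obtain ⟨x, hxV, hxW⟩ := nonempty_preirreducible_inter V.isOpen W.isOpen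
    (Set.nonempty_coe_sort.1 ‹Nonempty V›) (Set.nonempty_coe_sort.1 ‹Nonempty W›)
  obtain ⟨h, hh, hxh⟩ := hV.exists_basicOpen_le ⟨x, hxW⟩ hxV
  let := sectionsAlgebra f V
  let := sectionsAlgebra f (Y.basicOpen h)
  have := finiteType_sections f hV
  let : Algebra Γ(Y, V) Γ(Y, Y.basicOpen h) :=
    (Y.presheaf.map (homOfLE (Y.basicOpen_le h)).op).hom.toAlgebra
  have hloc : IsLocalization.Away h Γ(Y, Y.basicOpen h) := hV.isLocalization_basicOpen h
  have : IsScalarTower k Γ(Y, V) Γ(Y, Y.basicOpen h) := .of_algebraMap_eq' (by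
    change _ = ((((Scheme.ΓSpecIso (.of k)).inv ≫ f.appLE ⊤ V (le_preimage_top f V)) ≫
      Y.presheaf.map (homOfLE (Y.basicOpen_le h)).op).hom)
    rw [Category.assoc, Scheme.Hom.appLE_map]; rfl)
  have hh0 : h ≠ 0 := by
    rintro rfl
    simp at hxh
  rw [← ringKrullDim_eq_of_isLocalization_away k (B' := Γ(Y, Y.basicOpen h)) h hh0]
  exact ringKrullDim_le_of_affineOpens_le hW (hV.basicOpen h) hh

/-- A point of codimension at most one in an integral scheme locally of finite type over a field
has a closure of codimension at most one. -/
lemma topologicalKrullDim_le_closure_add_one [IsIntegral Y] (f : Y ⟶ Spec (.of k))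
    [LocallyOfFiniteType f] (x : Y) (hx : ringKrullDim (Y.presheaf.stalk x) ≤ 1) :
    topologicalKrullDim Y ≤ topologicalKrullDim (closure {x} : Set Y) + 1 := by
  obtain ⟨_, ⟨V, hV, rfl⟩, hxV, -⟩ :=
    Y.isBasis_affineOpens.exists_subset_of_mem_open (Set.mem_univ x) isOpen_univ
  have : Nonempty V := ⟨⟨x, hxV⟩⟩
  let := sectionsAlgebra f V
  have := finiteType_sections f hV
  let p := (hV.primeIdealOf ⟨x, hxV⟩)
  have hht : p.asIdeal.height ≤ 1 := by
    let := TopCat.Presheaf.algebra_section_stalk Y.presheaf ⟨x, hxV⟩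
    have : IsLocalization.AtPrime (Y.presheaf.stalk x) p.asIdeal := hV.isLocalization_stalk ⟨x, hxV⟩
    rw [IsLocalization.AtPrime.ringKrullDim_eq_height p.asIdeal] at hx
    exact_mod_cast hx
  have h1 := ringKrullDim_le_ringKrullDim_quotient_add_one k p.asIdeal hht
  have h2 : ringKrullDim (Γ(Y, V) ⧸ p.asIdeal) ≤ topologicalKrullDim (closure {x} : Set Y) := by
    rw [← PrimeSpectrum.topologicalKrullDim_eq_ringKrullDim]
    let φ : PrimeSpectrum (Γ(Y, V) ⧸ p.asIdeal) → Y :=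
      fun q ↦ hV.fromSpec (PrimeSpectrum.comap (Ideal.Quotient.mk p.asIdeal) q)
    have := hV.isOpenImmersion_fromSpec
    have hφ : Topology.IsInducing φ := hV.fromSpec.isOpenEmbedding.isInducing.comp
      (PrimeSpectrum.isClosedEmbedding_comap_of_surjective _ _
        Ideal.Quotient.mk_surjective).isInducing
    have hmem (q) : φ q ∈ closure ({x} : Set Y) := by
      rw [← specializes_iff_mem_closure]
      have h : p ⤳ PrimeSpectrum.comap (Ideal.Quotient.mk p.asIdeal) q := by
        rw [← PrimeSpectrum.le_iff_specializes]
        intro a ha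
        have : Ideal.Quotient.mk p.asIdeal a = 0 := Ideal.Quotient.eq_zero_iff_mem.2 ha
        simp [this]
      have h' := h.map hV.fromSpec.continuous
      rwa [hV.fromSpec_primeIdealOf ⟨x, hxV⟩] at h'
    exact (hφ.codRestrict hmem).topologicalKrullDim_le
  refine le_trans ?_ (h1.trans (by gcongr))
  -- All non-empty affine open subsets of `Y` have dimension at most that of `V`, so a bound on `V`
  -- is enough.
  refine topologicalKrullDim_le_of_forall_exists_open fun z ↦ ?_
  obtain ⟨_, ⟨W, hW, rfl⟩, hzW, -⟩ :=
    Y.isBasis_affineOpens.exists_subset_of_mem_open (Set.mem_univ z) isOpen_univ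
  have : Nonempty W := ⟨⟨z, hzW⟩⟩
  exact ⟨W, hzW, (topologicalKrullDim_eq_ringKrullDim hW).trans_le (ringKrullDim_sections_le f hW hV)⟩

end SchemeDim

end ACM

namespace ACM
noncomputable section
attribute [local instance] MvPolynomial.gradedAlgebra

/-! ### Projective space: properness, integrality, coordinate ratios -/

section Proj
variable (k : Type u) [Field k] (N : ℕ)

local notation "𝒜" => MvPolynomial.homogeneousSubmodule (Fin (N + 1)) k

lemma bijective_algebraMap_zero : Function.Bijective (algebraMap k (𝒜 0)) := by
  constructor
  · intro a b hab
    exact MvPolynomial.C_injective (Fin (N + 1)) k (congrArg Subtype.val hab)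
  · rintro ⟨p, hp⟩
    refine ⟨MvPolynomial.coeff 0 p, Subtype.ext ?_⟩
    have h : p.totalDegree = 0 := by
      have := MvPolynomial.IsHomogeneous.totalDegree_le (φ := p) (n := 0) hp
      omega
    exact ((MvPolynomial.totalDegree_eq_zero_iff_eq_C).1 h).symm

instance finiteType_zero : Algebra.FiniteType (𝒜 0) (MvPolynomial (Fin (N + 1)) k) :=
  have : IsScalarTower k (𝒜 0) (MvPolynomial (Fin (N + 1)) k) := ⟨fun a b c ↦ smul_mul_assoc a b.1 c⟩
  .of_restrictScalars_finiteType k _ _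

/-- The structure morphism of `ℙ^N`. -/
def projToSpec : ProjSpace k N ⟶ Spec (.of k) :=
  Proj.toSpecZero 𝒜 ≫ Spec.map (CommRingCat.ofHom (algebraMap k (𝒜 0)))

instance : IsProper (projToSpec k N) := by
  have : IsIso (CommRingCat.ofHom (algebraMap k (𝒜 0))) :=
    (ConcreteCategory.isIso_iff_bijective _).2 (bijective_algebraMap_zero k N)
  unfold projToSpec
  infer_instance

/-- The stalks are homogeneous localizations, which embed in localizations of the polynomial ring.
-/
instance : IsReduced (ProjSpace k N) := by
  have (x : ProjSpace k N) : _root_.IsReduced ((ProjSpace k N).presheaf.stalk x) := by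
    have hx := x.isPrime
    have h : IsDomain (Localization.AtPrime x.asHomogeneousIdeal.toIdeal) :=
      IsLocalization.isDomain_localization (Ideal.primeCompl_le_nonZeroDivisors _)
    have h2 : _root_.IsReduced
        (HomogeneousLocalization.AtPrime 𝒜 x.asHomogeneousIdeal.toIdeal) :=
      isReduced_of_injective (algebraMap _ (Localization.AtPrime x.asHomogeneousIdeal.toIdeal))
        (HomogeneousLocalization.val_injective _)
    exact isReduced_of_injective _ (Proj.stalkIso 𝒜 x).commRingCatIsoToRingEquiv.injective
  exact isReduced_of_isReduced_stalk _

lemma X_mem_irrelevant (j) : (MvPolynomial.X j : MvPolynomial (Fin (N + 1)) k) ∈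
    HomogeneousIdeal.irrelevant 𝒜 := by
  rw [HomogeneousIdeal.mem_irrelevant_iff]
  exact DirectSum.decompose_of_mem_ne 𝒜 (MvPolynomial.isHomogeneous_X k j) one_ne_zero

instance : IrreducibleSpace (ProjSpace k N) := by
  -- The zero ideal is a generic point; it is a point of `Proj` because the irrelevant ideal
  -- contains a variable.
  let η : ProjectiveSpectrum 𝒜 :=
    { asHomogeneousIdeal := ⊥
      isPrime := by
        rw [HomogeneousIdeal.toIdeal_bot]
        exact Ideal.isPrime_bot
      not_irrelevant_le := fun h ↦
        MvPolynomial.X_ne_zero (0 : Fin (N + 1)) (h (X_mem_irrelevant k N 0)) }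
  have : closure ({η} : Set (ProjectiveSpectrum 𝒜)) = Set.univ :=
    Set.eq_univ_of_forall fun x ↦ (ProjectiveSpectrum.le_iff_mem_closure 𝒜 η x).1
      (bot_le : (⊥ : HomogeneousIdeal 𝒜) ≤ _)
  have h2 : IsIrreducible (Set.univ : Set (ProjectiveSpectrum 𝒜)) := by
    rw [← this]
    exact isIrreducible_singleton.closure
  exact (irreducibleSpace_def _).2 h2

instance : IsIntegral (ProjSpace k N) := isIntegral_of_irreducibleSpace_of_isReduced _

lemma iSup_coordOpen : ⨆ j, coordOpen k N j = ⊤ := by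
  refine Proj.iSup_basicOpen_eq_top' 𝒜 _ (fun j ↦ ⟨1, MvPolynomial.isHomogeneous_X k j⟩) ?_
  rw [eq_top_iff]
  intro p _
  have : p ∈ Algebra.adjoin k (Set.range (MvPolynomial.X : Fin (N + 1) → MvPolynomial _ k)) := by
    rw [MvPolynomial.adjoin_range_X]; trivial
  induction this using Algebra.adjoin_induction with
  | mem x hx => exact Algebra.subset_adjoin hx
  | algebraMap r =>
    exact (Algebra.adjoin (𝒜 0) (Set.range MvPolynomial.X)).algebraMap_mem (algebraMap k (𝒜 0) r)
  | add x y _ _ h1 h2 => exact add_mem (h1 trivial) (h2 trivial)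
  | mul x y _ _ h1 h2 => exact mul_mem (h1 trivial) (h2 trivial)

lemma isAffineOpen_coordOpen (j) : IsAffineOpen (coordOpen k N j) :=
  Proj.isAffineOpen_basicOpen 𝒜 _ (MvPolynomial.isHomogeneous_X k j) zero_lt_one

lemma coordRatio_val (j l) (x : ProjSpace k N) (hx : x ∈ coordOpen k N j) :
    HomogeneousLocalization.val ((coordRatio k N j l).1 ⟨x, hx⟩) =
      haveI := x.isPrime
      Localization.mk (S := x.asHomogeneousIdeal.toIdeal.primeCompl) (MvPolynomial.X l)
        ⟨MvPolynomial.X j, hx⟩ := by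
  have := x.isPrime
  refine (ProjectiveSpectrum.Proj.awayToSection_apply 𝒜 _ _ _).trans ?_
  refine (congrArg _ (HomogeneousLocalization.Away.val_mk 𝒜 1
    (MvPolynomial.isHomogeneous_X k j) _ (MvPolynomial.isHomogeneous_X k l))).trans ?_
  rw [Localization.mk_eq_mk']
  refine (IsLocalization.map_mk' _ _ _).trans ?_
  rw [Localization.mk_eq_mk']
  congr 1
  exact Subtype.ext (pow_one _)

lemma coordRatio_self (j) : coordRatio k N j j = 1 := by
  apply Subtype.ext
  refine funext fun ⟨x, hx⟩ ↦ HomogeneousLocalization.val_injective _ ?_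
  have := ProjectiveSpectrum.isPrime x
  refine (coordRatio_val k N j j x hx).trans ?_
  refine (Localization.mk_self (S := x.asHomogeneousIdeal.toIdeal.primeCompl)
    ⟨MvPolynomial.X j, hx⟩).trans ?_
  exact (HomogeneousLocalization.val_one).symm

lemma coordRatio_mul (j m l) :
    ((ProjSpace k N).presheaf.map (homOfLE (inf_le_left : coordOpen k N j ⊓ coordOpen k N m ≤ _)).op).hom (coordRatio k N j l) =
    ((ProjSpace k N).presheaf.map (homOfLE inf_le_right).op).hom (coordRatio k N m l) *
    ((ProjSpace k N).presheaf.map (homOfLE inf_le_left).op).hom (coordRatio k N j m) := by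
  apply Subtype.ext
  refine funext fun ⟨x, hx⟩ ↦ HomogeneousLocalization.val_injective _ ?_
  have := ProjectiveSpectrum.isPrime x
  refine (coordRatio_val k N j l x hx.1).trans ?_
  refine Eq.trans ?_ (HomogeneousLocalization.val_mul _ _).symm
  refine Eq.trans ?_ (congrArg₂ (· * ·) (coordRatio_val k N m l x hx.2) (coordRatio_val k N j m x hx.1)).symm
  rw [Localization.mk_mul, Localization.mk_eq_mk_iff, Localization.r_iff_exists]
  exact ⟨1, by simp; ring⟩

/-- In the stalk at a homogeneous prime, the fraction `X_l / X_j` is a unit only if its numerator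
lies outside the prime. -/
lemma basicOpen_coordRatio_le (j l) :
    (ProjSpace k N).basicOpen (coordRatio k N j l) ≤ coordOpen k N l := by
  intro x hx
  have hxj := (ProjSpace k N).basicOpen_le _ hx
  rw [Scheme.mem_basicOpen _ _ _ hxj] at hx
  intro hl
  have h := hx.map (Proj.stalkIso 𝒜 x).hom.hom
  have := x.isPrime
  have e : (Proj.stalkIso 𝒜 x).hom.hom ((ProjSpace k N).presheaf.germ _ x hxj (coordRatio k N j l)) =
      (coordRatio k N j l).1 ⟨x, hxj⟩ := by
    exact Proj.stalkIso'_germ 𝒜 _ x hxj _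
  rw [e, ← HomogeneousLocalization.isUnit_iff_isUnit_val, coordRatio_val, Localization.mk_eq_mk',
    IsLocalization.AtPrime.isUnit_mk'_iff _ x.asHomogeneousIdeal.toIdeal] at h
  exact h hl
end Proj

/-! ### Charts and coordinate ratios on a scheme over projective space -/

section Ratio

variable {k : Type u} [Field k] {N : ℕ} {Z : Scheme.{u}} (f : Z ⟶ ProjSpace k N)

lemma iSup_chart : ⨆ j, chart f j = ⊤ := by
  refine eq_top_iff.2 fun z _ ↦ Opens.mem_iSup.2 ?_
  have h : f z ∈ ⨆ j, coordOpen k N j := by rw [iSup_coordOpen]; trivial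
  exact (Opens.mem_iSup (s := fun j ↦ coordOpen k N j)).1 h

lemma exists_mem_chart (z : Z) : ∃ j, z ∈ chart f j := by
  have : z ∈ ⨆ j, chart f j := by rw [iSup_chart]; trivial
  exact Opens.mem_iSup.1 this

lemma isAffineOpen_chart [IsAffineHom f] (j) : IsAffineOpen (chart f j) :=
  (isAffineOpen_coordOpen k N j).preimage f

lemma ratio_self (j) : ratio f j j = 1 := by
  rw [ratio, coordRatio_self]
  exact map_one _

lemma ratioOn_self (j) {W : Z.Opens} (h : W ≤ chart f j) : ratioOn f j j h = 1 := by
  rw [ratioOn, ratio_self, map_one]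

lemma ratioOn_eq (j l) {W : Z.Opens} (h : W ≤ chart f j) :
    ratioOn f j l h = (f.appLE (coordOpen k N j) W h).hom (coordRatio k N j l) := rfl

lemma ratioOn_mul (j m l) {W : Z.Opens} (hj : W ≤ chart f j) (hm : W ≤ chart f m) :
    ratioOn f j l hj = ratioOn f m l hm * ratioOn f j m hj := by
  have h : W ≤ f ⁻¹ᵁ (coordOpen k N j ⊓ coordOpen k N m) := le_inf hj hm
  have := congrArg (f.appLE _ W h).hom (coordRatio_mul k N j m l)
  rw [map_mul] at this
  simp only [← CommRingCat.comp_apply, Scheme.Hom.map_appLE] at this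
  exact this

lemma basicOpen_ratioOn_le (j l) {W : Z.Opens} (hj : W ≤ chart f j) :
    Z.basicOpen (ratioOn f j l hj) ≤ chart f l := by
  rw [ratioOn, Scheme.basicOpen_res]
  refine inf_le_right.trans ?_
  exact (Scheme.preimage_basicOpen f (coordRatio k N j l)).ge.trans
    fun x hx ↦ basicOpen_coordRatio_le k N j l hx

end Ratio

end

end ACM

namespace ACM
noncomputable section

/-! ### Sections of ideal sheaves -/

section IdealModule
variable {X Z : Scheme.{u}} (f : Z ⟶ X)

/-- The inclusion of the ideal sheaf in the structure sheaf. -/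
def idealι : idealModule f ⟶ structureModule X := Limits.kernel.ι (unitToPushforward f)

instance : Mono (idealι f) := inferInstanceAs (Mono (Limits.kernel.ι (unitToPushforward f)))

lemma idealι_comp : idealι f ≫ unitToPushforward f = 0 := Limits.kernel.condition _

/-- The sections over `V` of the ideal sheaf, as functions. -/
def idealSections (V : X.Opens) : Γ(idealModule f, V) →ₗ[Γ(X, V)] Γ(X, V) where
  toFun x := (idealι f).app V x
  map_add' x y := ((idealι f).app V).hom.map_add x y
  map_smul' r x := (idealι f).app_smul r x

/-- The functor of sections over `V`, in abelian groups. -/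
def sectionsFunctor (V : X.Opens) : X.Modules ⥤ Ab.{u} :=
  Scheme.Modules.toPresheaf X ⋙ (evaluation _ _).obj (op V)

instance (V : X.Opens) : (sectionsFunctor V).PreservesZeroMorphisms := ⟨fun _ _ ↦ rfl⟩

instance (V : X.Opens) : Limits.PreservesFiniteLimits (sectionsFunctor V) where
  preservesFiniteLimits J _ _ := by
    have := Limits.PreservesLimitsOfSize.preservesFiniteLimits (Scheme.Modules.toPresheaf X)
    have : Limits.HasLimitsOfShape J Ab.{u} := Limits.HasFiniteLimits.out J
    have : Limits.PreservesLimitsOfShape J ((evaluation (Opens X)ᵒᵖ Ab.{u}).obj (op V)) :=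
      Limits.evaluation_preservesLimitsOfShape (op V)
    exact Limits.comp_preservesLimitsOfShape _ _

/-- Left exactness of sections identifies the sections of the categorical kernel with the kernel on
sections. -/
lemma exact_sections_idealι (V : X.Opens) :
    ((ShortComplex.mk (idealι f) (unitToPushforward f) (idealι_comp f)).map
      (sectionsFunctor V)).Exact := by
  refine ShortComplex.Exact.map_of_mono_of_preservesKernel
    (ShortComplex.exact_of_f_is_kernel _ ?_) _ ?_ ?_
  · exact Limits.kernelIsKernel (unitToPushforward f)
  · exact inferInstanceAs (Mono (idealι f))
  · infer_instance

lemma idealSections_injective (V : X.Opens) : Function.Injective (idealSections f V) := by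
  have := (inferInstance : Mono ((sectionsFunctor V).map (idealι f)))
  exact (AddCommGrpCat.mono_iff_injective _).1 this

lemma range_idealSections (V : X.Opens) :
    LinearMap.range (idealSections f V) = RingHom.ker (f.app V).hom := by
  have := (ShortComplex.ab_exact_iff _).1 (exact_sections_idealι f V)
  ext a
  constructor
  · rintro ⟨x, rfl⟩
    exact ConcreteCategory.congr_hom
      (congrArg (fun φ ↦ Scheme.Modules.Hom.app φ V) (idealι_comp f)) x
  · intro ha
    exact this a ha

/-- Sections of the ideal sheaf are the functions that vanish on the closed subscheme. -/
def idealSectionsEquiv (V : X.Opens) :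
    Γ(idealModule f, V) ≃ₗ[Γ(X, V)] RingHom.ker (f.app V).hom :=
  (LinearEquiv.ofInjective _ (idealSections_injective f V)).trans
    (LinearEquiv.ofEq _ _ (range_idealSections f V))

lemma idealSections_res {U V : X.Opens} (h : V ≤ U) (x : Γ(idealModule f, U)) :
    idealSections f V (res _ h x) = (X.presheaf.map (homOfLE h).op).hom (idealSections f U x) :=
  ConcreteCategory.congr_hom ((idealι f).mapPresheaf.naturality (homOfLE h).op) x

end IdealModule

/-! ### Local freeness in terms of sections -/

section Free
variable {X : Scheme.{u}}

/-- The free module of rank `r`. -/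
abbrev freeModule (X : Scheme.{u}) (r : ℕ) : X.Modules :=
  (SheafOfModules.free (R := X.ringCatSheaf) (ULift.{u} (Fin r)) : SheafOfModules X.ringCatSheaf)

/-- The sections of a free module of finite rank. -/
lemma nonempty_free_linearEquiv (V : X.Opens) (r : ℕ) :
    Nonempty ((Fin r → Γ(X, V)) ≃ₗ[Γ(X, V)] Γ(freeModule X r, V)) := by
  have := Abelian.hasFiniteBiproducts (C := SheafOfModules.{u} X.ringCatSheaf)
  let G := SheafOfModules.evaluation.{u} X.ringCatSheaf (op V)
  let F : ULift.{u} (Fin r) → SheafOfModules.{u} X.ringCatSheaf := fun _ ↦ SheafOfModules.unit _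
  let R := X.ringCatSheaf.obj.obj (op V)
  -- A finite coproduct is a product, and taking sections preserves products.
  let e : G.obj (∐ F) ≅ ModuleCat.of R (∀ i, G.obj (F i)) :=
    G.mapIso ((Limits.biproduct.isoCoproduct F).symm ≪≫ Limits.biproduct.isoProduct F) ≪≫
      Limits.PreservesProduct.iso G F ≪≫ ModuleCat.piIsoPi _
  let e₁ : (ULift.{u} (Fin r) → R) ≃ₗ[R] G.obj (∐ F) := e.symm.toLinearEquiv
  let e₂ : (Fin r → R) ≃ₗ[R] (ULift.{u} (Fin r) → R) :=
    LinearEquiv.funCongrLeft R R Equiv.ulift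
  let e₃ : (Fin r → R) ≃ₗ[R] G.obj (∐ F) := e₂.trans e₁
  exact ⟨e₃⟩

lemma exists_image_eq {U V : X.Opens} (h : V ≤ U) : ∃ V' : U.toScheme.Opens, U.ι ''ᵁ V' = V :=
  ⟨U.ι ⁻¹ᵁ V, by simp [Scheme.Hom.image_preimage_eq_opensRange_inf, h]⟩

/-- A module that is free over `U` has free sections over every open subset of `U`. -/
lemma exists_linearEquiv_of_isLocallyFreeAt {M : X.Modules} {p : X} (h : IsLocallyFreeAt M p) :
    ∃ U : X.Opens, p ∈ U ∧ ∃ r : ℕ, ∀ V ≤ U,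
      Nonempty ((Fin r → Γ(X, V)) ≃ₗ[Γ(X, V)] Γ(M, V)) := by
  obtain ⟨U, hp, r, ⟨e⟩⟩ := h
  refine ⟨U, hp, r, fun V hV ↦ ?_⟩
  obtain ⟨V', rfl⟩ := exists_image_eq hV
  obtain ⟨e₁⟩ := nonempty_free_linearEquiv V' r
  have e₂ : Γ(freeModule U.toScheme r, V') ≃ₗ[Γ(U.toScheme, V')] Γ(M.restrict U.ι, V') :=
    { toFun := e.inv.app V'
      invFun := e.hom.app V'
      map_add' x y := (e.inv.app V').hom.map_add x y
      map_smul' r x := e.inv.app_smul r x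
      left_inv x := ConcreteCategory.congr_hom
        (congrArg (fun φ ↦ Scheme.Modules.Hom.app φ V') e.inv_hom_id) x
      right_inv x := ConcreteCategory.congr_hom
        (congrArg (fun φ ↦ Scheme.Modules.Hom.app φ V') e.hom_inv_id) x }
  refine ⟨{ toFun x := e₂ (e₁ x)
            invFun x := e₁.symm (e₂.symm x)
            map_add' x y := (congrArg e₂ (e₁.map_add x y)).trans (e₂.map_add _ _)
            map_smul' a x := ?_
            left_inv x := (congrArg e₁.symm (e₂.symm_apply_apply _)).trans (e₁.symm_apply_apply x)
            right_inv x := (congrArg e₂ (e₁.apply_symm_apply _)).trans (e₂.apply_symm_apply _) }⟩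
  have h₁ := e₁.map_smul (show Γ(U.toScheme, V') from a) x
  refine (congrArg e₂ h₁).trans ((e₂.map_smul _ _).trans ?_)
  have h₂ := Scheme.Modules.smul_restrictAppIso_hom_apply U.ι M V' a (e₂ (e₁ x))
  refine h₂.trans ?_
  rw [Scheme.Opens.ι_appIso]
  rfl

lemma IsLocallyFreeAt.of_iso {M M' : X.Modules} (e : M ≅ M') {p : X} (h : IsLocallyFreeAt M p) :
    IsLocallyFreeAt M' p := by
  obtain ⟨U, hp, r, ⟨e'⟩⟩ := h
  exact ⟨U, hp, r, ⟨(Scheme.Modules.restrictFunctor U.ι).mapIso e.symm ≪≫ e'⟩⟩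

/-- A module generated over `U` by one section `m` without annihilator is locally free on `U`. -/
lemma isLocallyFreeAt_of_bijective_smul {M : X.Modules} {U : X.Opens} (m : Γ(M, U))
    (h : ∀ V : X.affineOpens, ∀ hV : V.1 ≤ U,
      Function.Bijective fun a : Γ(X, V.1) ↦ a • res M hV m) {p : X} (hp : p ∈ U) :
    IsLocallyFreeAt M p := by
  let M' : SheafOfModules U.toScheme.ringCatSheaf := M.restrict U.ι
  let s : M'.sections := PresheafOfModules.sectionsMk
    (fun V ↦ res M (U.ι_image_le V.unop) m) (fun V W g ↦ res_res M (U.ι_image_le V.unop)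
      (U.ι.image_mono (leOfHom g.unop)) m)
  let φ : structureModule U.toScheme ⟶ M.restrict U.ι := M'.unitHomEquiv.symm s
  have hφ (V : U.toScheme.Opens) (a : Γ(X, U.ι ''ᵁ V)) :
      φ.app V a = a • res M (U.ι_image_le V) m := by
    have h₂ := Scheme.Modules.smul_restrictAppIso_hom_apply U.ι M V a
      (res M (U.ι_image_le V) m)
    refine Eq.trans ?_ (h₂.trans ?_)
    · rfl
    · rw [Scheme.Opens.ι_appIso]
      rfl
  -- An isomorphism of sheaves can be tested on the basis of affine open subsets.
  have : IsIso φ := by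
    let ψ : (⟨_, (structureModule U.toScheme).isSheaf⟩ : TopCat.Sheaf Ab.{u} U.toScheme) ⟶
      ⟨_, (M.restrict U.ι).isSheaf⟩ := ⟨φ.mapPresheaf⟩
    have hψ : IsIso ψ := by
      refine TopCat.Sheaf.isIso_iff_isIso_basis
        (B := fun V : U.toScheme.affineOpens ↦ V.1) ?_ fun V ↦ ?_
      · simpa using U.toScheme.isBasis_affineOpens
      · rw [ConcreteCategory.isIso_iff_bijective]
        have e : (fun a : Γ(X, U.ι ''ᵁ V.1) ↦ (φ.app V.1 a : Γ(M, U.ι ''ᵁ V.1))) =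
            fun a : Γ(X, U.ι ''ᵁ V.1) ↦ a • res M (U.ι_image_le V.1) m := funext (hφ V.1)
        have h₃ := h ⟨U.ι ''ᵁ V.1, V.2.image_of_isOpenImmersion U.ι⟩ (U.ι_image_le V.1)
        exact (congrArg Function.Bijective e).mpr h₃
    have : IsIso ((Scheme.Modules.toPresheaf _).map φ) :=
      inferInstanceAs (IsIso ((sheafToPresheaf _ _).map ψ))
    exact isIso_of_reflects_iso φ (Scheme.Modules.toPresheaf _)
  refine ⟨U, hp, 1, ⟨(asIso φ).symm ≪≫ ?_⟩⟩
  exact (Limits.coproductUniqueIso (fun _ : ULift.{u} (Fin 1) ↦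
    SheafOfModules.unit U.toScheme.ringCatSheaf)).symm

/-- The ideal sheaf of a closed subscheme is locally free where it is generated by one
nonzerodivisor. -/
lemma isLocallyFreeAt_idealModule {Z : Scheme.{u}} (f : Z ⟶ X) {U : X.Opens} (g : Γ(X, U))
    (hg : (f.app U).hom g = 0)
    (h : ∀ V : X.affineOpens, ∀ hV : V.1 ≤ U,
      (X.presheaf.map (homOfLE hV).op).hom g ∈ nonZeroDivisors Γ(X, V.1) ∧
      RingHom.ker (f.app V.1).hom ≤ Ideal.span {(X.presheaf.map (homOfLE hV).op).hom g})
    {p : X} (hp : p ∈ U) : IsLocallyFreeAt (idealModule f) p := by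
  obtain ⟨m, hm⟩ : g ∈ LinearMap.range (idealSections f U) := by
    rw [range_idealSections]; exact hg
  refine isLocallyFreeAt_of_bijective_smul m (fun V hV ↦ ⟨fun a b hab ↦ ?_, fun x ↦ ?_⟩) hp
  · have := congrArg (idealSections f V.1) hab
    simp only [map_smul, idealSections_res, hm, smul_eq_mul] at this
    exact (mul_cancel_right_mem_nonZeroDivisors (h V hV).1).1 this
  · have hx : idealSections f V.1 x ∈ RingHom.ker (f.app V.1).hom := by
      rw [← range_idealSections]; exact ⟨x, rfl⟩
    obtain ⟨a, ha⟩ := Ideal.mem_span_singleton'.1 ((h V hV).2 hx)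
    refine ⟨a, idealSections_injective f V.1 ?_⟩
    simp only [map_smul, idealSections_res, hm, smul_eq_mul]
    exact ha

end Free

end
end ACM

namespace ACM
noncomputable section

/-! ### Vanishing of `H^1` and connectedness -/

section Cohomology
variable {X Z : Scheme.{u}}

/-- The underlying sheaf of abelian groups of a module. -/
def abSheaf (X : Scheme.{u}) :
    X.Modules ⥤ Sheaf (Opens.grothendieckTopology X) Ab.{u} :=
  SheafOfModules.toSheaf X.ringCatSheaf

instance : (abSheaf X).PreservesZeroMorphisms := ⟨fun _ _ ↦ rfl⟩

instance : Limits.PreservesFiniteLimits (abSheaf X) :=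
  inferInstanceAs (Limits.PreservesFiniteLimits (SheafOfModules.toSheaf X.ringCatSheaf))

lemma exact_abSheaf_idealι (f : Z ⟶ X) :
    ((ShortComplex.mk (idealι f) (unitToPushforward f) (idealι_comp f)).map (abSheaf X)).Exact := by
  refine ShortComplex.Exact.map_of_mono_of_preservesKernel
    (ShortComplex.exact_of_f_is_kernel _ ?_) _ ?_ ?_
  · exact Limits.kernelIsKernel (unitToPushforward f)
  · exact inferInstanceAs (Mono (idealι f))
  · infer_instance

/-- A closed immersion is surjective on functions over each affine open subset of `X`, which gives
local surjectivity. -/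
instance epi_unitToPushforward (f : Z ⟶ X) [IsClosedImmersion f] :
    Epi ((abSheaf X).map (unitToPushforward f)) := by
  refine (TopCat.Sheaf.isLocallySurjective_iff_epi (X := X.carrier) _).1 ?_
  rw [TopCat.Presheaf.isLocallySurjective_iff]
  intro U t x hx
  obtain ⟨_, ⟨V, hV, rfl⟩, hxV, hVU⟩ := X.isBasis_affineOpens.exists_subset_of_mem_open hx U.2
  exact ⟨V, hVU, f.app_surjective V hV _, hxV⟩

lemma shortExact_idealι (f : Z ⟶ X) [IsClosedImmersion f] :
    ((ShortComplex.mk (idealι f) (unitToPushforward f) (idealι_comp f)).map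
      (abSheaf X)).ShortExact where
  exact := exact_abSheaf_idealι f
  mono_f := inferInstanceAs (Mono ((abSheaf X).map (idealι f)))
  epi_g := epi_unitToPushforward f

/-- By the long exact sequence, the obstruction to lifting a global function from `Z` lies in `H^1`
of the ideal sheaf. -/
lemma surjective_app_top_of_subsingleton_H (f : Z ⟶ X) [IsClosedImmersion f]
    (h : Subsingleton (((abSheaf X).obj (idealModule f)).H 1)) :
    Function.Surjective (f.app ⊤).hom := by
  intro y
  let S := (ShortComplex.mk (idealι f) (unitToPushforward f) (idealι_comp f)).map (abSheaf X)
  have hS : S.ShortExact := shortExact_idealι f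
  have hT : Limits.IsTerminal (⊤ : Opens X) := Limits.isTerminalTop
  let y' : S.X₃.obj.obj (op ⊤) := y
  have h' : Subsingleton (S.X₁.H 1) := h
  obtain ⟨x, hx⟩ := Abelian.Ext.covariant_sequence_exact₃ _ hS ((Sheaf.H.equiv₀ S.X₃ hT).symm y')
    rfl (Subsingleton.elim _ _)
  have := Sheaf.H.equiv₀_naturality hT S.g x
  rw [Sheaf.H.map_apply, hx, AddEquiv.apply_symm_apply] at this
  exact ⟨_, this⟩

lemma eq_bot_of_subsingleton {U : X.Opens} (h : Subsingleton Γ(X, U)) : U = ⊥ := by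
  refine eq_bot_iff.2 fun x hx ↦ ?_
  have := congrArg (X.presheaf.germ U x hx).hom (Subsingleton.elim (0 : Γ(X, U)) 1)
  rw [map_zero, map_one] at this
  exact (zero_ne_one this).elim

/-- A scheme whose ring of functions is a quotient of a field is connected. -/
lemma preconnectedSpace_of_surjective_of_isField {K : Type*} [CommRing K] (hK : IsField K)
    (φ : K →+* Γ(X, ⊤)) (hφ : Function.Surjective φ) : PreconnectedSpace X := by
  rw [preconnectedSpace_iff_clopen]
  intro s hs
  let U : ULift.{u} Bool → X.Opens := fun b ↦
    if b.down then ⟨s, hs.isOpen⟩ else ⟨sᶜ, hs.compl.isOpen⟩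
  -- These glue to the idempotent that is `1` on `s` and `0` on its complement. It lifts to an
  -- element of `K`, which is zero or invertible, so one of the two pieces is empty.
  let sf : ∀ b, Γ(X, U b) := fun b ↦ ((if b.down then 1 else 0 : ℕ) : Γ(X, U b))
  have hcov : (⊤ : X.Opens) ≤ iSup U := by
    intro x _
    by_cases hx : x ∈ s
    · exact Opens.mem_iSup.2 ⟨⟨true⟩, hx⟩
    · exact Opens.mem_iSup.2 ⟨⟨false⟩, hx⟩
  have hcomp : TopCat.Presheaf.IsCompatible X.sheaf.obj U sf := by
    intro b b'
    by_cases hb : b = b'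
    · subst hb; rfl
    · have : U b ⊓ U b' = ⊥ := by
        rcases b with ⟨_ | _⟩ <;> rcases b' with ⟨_ | _⟩ <;> first | (exact (hb rfl).elim) | skip
        · exact Opens.ext (Set.compl_inter_self s)
        · exact Opens.ext (Set.inter_compl_self s)
      have : Subsingleton Γ(X, U b ⊓ U b') := by rw [this]; infer_instance
      exact Subsingleton.elim (α := Γ(X, U b ⊓ U b')) _ _
  obtain ⟨e, he, -⟩ := X.sheaf.existsUnique_gluing' U ⊤ (fun b ↦ homOfLE le_top) hcov sf hcomp
  obtain ⟨a, rfl⟩ := hφ e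
  have key (b) : (X.presheaf.map (homOfLE (le_top : U b ≤ ⊤)).op).hom (φ a) = sf b := he b
  by_cases ha : a = 0
  · left
    have h := key ⟨true⟩
    rw [ha, map_zero, map_zero] at h
    have h' : (0 : Γ(X, U ⟨true⟩)) = 1 := h.trans (Nat.cast_one)
    exact congrArg (fun V : X.Opens ↦ (V : Set X))
      (eq_bot_of_subsingleton (subsingleton_of_zero_eq_one h'))
  · right
    obtain ⟨b, hb⟩ := hK.mul_inv_cancel ha
    have h := congrArg (X.presheaf.map (homOfLE (le_top : U ⟨false⟩ ≤ ⊤)).op).hom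
      (congrArg φ hb)
    rw [map_mul, map_mul, key, map_one, map_one] at h
    have h' : (0 : Γ(X, U ⟨false⟩)) = 1 := by
      rw [← h, show sf ⟨false⟩ = 0 from Nat.cast_zero, zero_mul]
    have := congrArg (fun V : X.Opens ↦ (V : Set X))
      (eq_bot_of_subsingleton (subsingleton_of_zero_eq_one h'))
    exact Set.compl_empty_iff.1 this

variable {k : Type u} [Field k] {N : ℕ}

/-- The twist `M(0)` is `M`. -/
def toTwistZero (f : Z ⟶ ProjSpace k N) (M : Z.Modules) : (abSheaf Z).obj M ⟶ twist f M 0 where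
  hom :=
    { app U := AddCommGrpCat.ofHom
        { toFun x := ⟨fun j ↦ res M inf_le_left x, fun j l ↦ by
            simp only [Int.toNat_zero, neg_zero, pow_zero, one_smul]
            exact (res_res M _ _ x).trans (res_res M _ _ x).symm⟩
          map_zero' := Subtype.ext (funext fun j ↦ map_zero (res M inf_le_left))
          map_add' x y := Subtype.ext (funext fun j ↦ map_add (res M inf_le_left) x y) }
      naturality U V g := by
        ext x
        refine Subtype.ext (funext fun j ↦ ?_)
        exact (res_res M (leOfHom g.unop) inf_le_left x).trans
          (res_res M inf_le_left (inf_le_inf_right _ (leOfHom g.unop)) x).symm }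

/-- In degree zero the gluing relation says that the `s_j` agree on overlaps, so the claim is the
sheaf axiom for the cover by charts. -/
instance (f : Z ⟶ ProjSpace k N) (M : Z.Modules) : IsIso (toTwistZero f M) := by
  have : IsIso ((sheafToPresheaf _ _).map (toTwistZero f M)) := by
    rw [NatTrans.isIso_iff_isIso_app]
    intro U
    rw [ConcreteCategory.isIso_iff_bijective]
    have hcov : U.unop ≤ ⨆ j : ULift.{u} (Fin (N + 1)), U.unop ⊓ chart f j.down := by
      intro z hz
      obtain ⟨j, hj⟩ := exists_mem_chart f z
      exact Opens.mem_iSup.2 ⟨⟨j⟩, hz, hj⟩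
    constructor
    · intro x y hxy
      refine res_ext M (fun j : ULift.{u} (Fin (N + 1)) ↦ U.unop ⊓ chart f j.down)
        (fun j ↦ inf_le_left) hcov fun j ↦ ?_
      exact congrFun (congrArg Subtype.val hxy) j.down
    · rintro ⟨s, hs⟩
      obtain ⟨x, hx, -⟩ := TopCat.Sheaf.existsUnique_gluing' ⟨M.presheaf, M.isSheaf⟩
        (fun j : ULift.{u} (Fin (N + 1)) ↦ U.unop ⊓ chart f j.down) U.unop
        (fun j ↦ homOfLE inf_le_left) hcov (fun j ↦ s j.down) (fun j l ↦ by
          have := hs j.down l.down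
          simp only [Int.toNat_zero, neg_zero, pow_zero, one_smul] at this
          have h2 := congrArg (res M (V := (U.unop ⊓ chart f j.down) ⊓ (U.unop ⊓ chart f l.down))
            (le_inf (inf_le_left.trans inf_le_left)
              (le_inf (inf_le_left.trans inf_le_right) (inf_le_right.trans inf_le_right)))) this
          rw [res_res, res_res] at h2
          exact h2.symm)
      exact ⟨x, Subtype.ext (funext fun j ↦ hx ⟨j⟩)⟩
  exact isIso_of_reflects_iso _ (sheafToPresheaf _ _)

/-- A closed subscheme of `ℙ^N` with `H^1(I_X) = 0` is connected. -/
lemma preconnectedSpace_of_hasACMVanishing (i : X ⟶ ProjSpace k N)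
    [IsClosedImmersion i] {n : ℕ} (hn : 2 ≤ n) (h : HasACMVanishing i n) :
    PreconnectedSpace X := by
  have h1 : Subsingleton (((abSheaf _).obj (idealModule i)).H 1) := by
    -- The index `1` is in the range `1 ≤ i ≤ n - 1` because `n ≥ 2`.
    have := h 0 1 le_rfl (by omega)
    let e := (Sheaf.functorH _ 1).mapIso (asIso (toTwistZero (𝟙 _) (idealModule i)))
    refine @Function.Injective.subsingleton _ _ _
      e.addCommGroupIsoToAddEquiv.injective this
  exact preconnectedSpace_of_surjective_of_isField
    (isField_of_universallyClosed k (projToSpec k N)) (i.app ⊤).hom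
    (surjective_app_top_of_subsingleton_H i h1)

end Cohomology
end
end ACM

namespace ACM
noncomputable section

/-! ### Reduced closed subschemes and stalks -/

section Reduced
variable {X : Scheme.{u}}

lemma exists_affineOpens_le {U : X.Opens} {x : X} (hx : x ∈ U) :
    ∃ V : X.affineOpens, x ∈ V.1 ∧ V.1 ≤ U := by
  obtain ⟨_, ⟨V, hV, rfl⟩, hxV, hVU⟩ := X.isBasis_affineOpens.exists_subset_of_mem_open hx U.2
  exact ⟨⟨V, hV⟩, hxV, hVU⟩

lemma isReduced_subscheme {I : X.IdealSheafData} (h : ∀ V, (I.ideal V).IsRadical) :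
    IsReduced I.subscheme := by
  have (V : X.affineOpens) : IsReduced (I.subschemeCover.openCover.X V) := by
    have : _root_.IsReduced (Γ(X, V.1) ⧸ I.ideal V) :=
      (Ideal.isRadical_iff_quotient_reduced _).1 (h V)
    exact inferInstanceAs (IsReduced (Spec (.of (Γ(X, V.1) ⧸ I.ideal V))))
  exact @IsReduced.of_openCover _ I.subschemeCover.openCover this

lemma isRadical_ideal (I : X.IdealSheafData) [IsReduced I.subscheme] (V : X.affineOpens) :
    (I.ideal V).IsRadical := by
  rw [← I.ker_subschemeι_app V]
  exact (RingHom.ker_isRadical_iff_reduced_of_surjective (I.subschemeι_app_surjective V)).2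
    inferInstance

/-- A closed subscheme that is reduced is determined by its support. -/
lemma eq_of_support_eq {I J : X.IdealSheafData} [IsReduced I.subscheme] [IsReduced J.subscheme]
    (h : I.support = J.support) : I = J := by
  have key (I : X.IdealSheafData) [IsReduced I.subscheme] :
      Scheme.IdealSheafData.vanishingIdeal I.support = I := by
    rw [Scheme.IdealSheafData.vanishingIdeal_support]
    ext V : 2
    exact (isRadical_ideal I V).radical
  rw [← key I, ← key J, h]

instance (Y : Closeds X) : IsReduced (reducedScheme Y) :=
  isReduced_subscheme fun _ ↦ PrimeSpectrum.isRadical_vanishingIdeal _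

lemma range_reducedι (Y : Closeds X) : Set.range (reducedι Y) = Y := by
  rw [Scheme.IdealSheafData.range_subschemeι, Scheme.IdealSheafData.coe_support_vanishingIdeal]

lemma reducedι_mem (Y : Closeds X) (t : reducedScheme Y) : reducedι Y t ∈ Y := by
  have : reducedι Y t ∈ (Y : Set X) := by
    rw [← range_reducedι]; exact ⟨t, rfl⟩
  exact this

lemma isIntegral_reducedScheme {Y : Closeds X} (hY : IsIrreducible (Y : Set X)) :
    IsIntegral (reducedScheme Y) := by
  have : IrreducibleSpace (reducedScheme Y) := by
    refine Subtype.irreducibleSpace ?_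
    rw [Scheme.IdealSheafData.coe_support_vanishingIdeal]
    exact hY
  exact isIntegral_of_irreducibleSpace_of_isReduced _

/-- The kernel of `𝒪_{X,x} ⟶ 𝒪_{Z,x}` for a closed subscheme `Z` of `X`. -/
lemma exists_mem_ideal_of_stalkMap_eq_zero (I : X.IdealSheafData) (t : I.subscheme) {U : X.Opens}
    (ht : I.subschemeι t ∈ U) (a : Γ(X, U))
    (h : I.subschemeι.stalkMap t (X.presheaf.germ U _ ht a) = 0) :
    ∃ (W : X.affineOpens) (hW : W.1 ≤ U), I.subschemeι t ∈ W.1 ∧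
      (X.presheaf.map (homOfLE hW).op).hom a ∈ I.ideal W := by
  rw [Scheme.Hom.germ_stalkMap_apply] at h
  have h0 : (I.subscheme.presheaf.germ (I.subschemeι ⁻¹ᵁ U) t ht) (I.subschemeι.app U a) =
    (I.subscheme.presheaf.germ (I.subschemeι ⁻¹ᵁ U) t ht) 0 := by rw [h, map_zero]
  obtain ⟨W', htW', i₁, i₂, e⟩ := I.subscheme.presheaf.germ_eq t ht ht _ _ h0
  -- The subscheme carries the induced topology, so the neighbourhood `W'` where the germ vanishes
  -- is the trace of an open subset of `X`.
  obtain ⟨O, hO, hOW⟩ := (I.subschemeι.isEmbedding.isInducing.isOpen_iff).1 W'.2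
  have htO : I.subschemeι t ∈ O := by
    have : t ∈ I.subschemeι ⁻¹' O := by rw [hOW]; exact htW'
    exact this
  obtain ⟨W, htW, hW⟩ := exists_affineOpens_le (U := ⟨O, hO⟩ ⊓ U) ⟨htO, ht⟩
  refine ⟨W, hW.trans inf_le_right, htW, ?_⟩
  have hle : I.subschemeι ⁻¹ᵁ W.1 ≤ W' := by
    intro y hy
    have : y ∈ I.subschemeι ⁻¹' O := (hW hy).1
    rw [hOW] at this
    exact this
  rw [← I.ker_subschemeι_app W, RingHom.mem_ker]
  have h1 := congrArg (I.subscheme.presheaf.map (homOfLE hle).op) e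
  rw [map_zero, map_zero, ← ConcreteCategory.comp_apply, ← Functor.map_comp] at h1
  have h2 := ConcreteCategory.congr_hom
    (I.subschemeι.naturality (homOfLE (hW.trans inf_le_right)).op) a
  exact h2.trans h1

lemma ideal_eq_bot_of_le {I : X.IdealSheafData} {V W : X.affineOpens} (h : I.ideal V = ⊥)
    (hW : W ≤ V) : I.ideal W = ⊥ := by
  rw [← I.map_ideal hW, h, Ideal.map_bot]

lemma bijective_stalkMap_of_ideal_eq_bot {I : X.IdealSheafData} {V : X.affineOpens}
    (h : I.ideal V = ⊥) (t : I.subscheme) (ht : I.subschemeι t ∈ V.1) :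
    Function.Bijective (I.subschemeι.stalkMap t).hom := by
  refine ⟨?_, I.subschemeι.stalkMap_surjective t⟩
  rw [injective_iff_map_eq_zero]
  intro b hb
  obtain ⟨U, hU, a, rfl⟩ := X.presheaf.exists_germ_eq b
  have hUV : I.subschemeι t ∈ U ⊓ V.1 := ⟨hU, ht⟩
  rw [← X.presheaf.germ_res_apply (homOfLE (inf_le_left : U ⊓ V.1 ≤ U)) _ hUV] at hb ⊢
  obtain ⟨W, hW, htW, hWI⟩ := exists_mem_ideal_of_stalkMap_eq_zero I t hUV _ hb
  rw [ideal_eq_bot_of_le h (show W ≤ V from hW.trans inf_le_right), Ideal.mem_bot] at hWI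
  rw [← X.presheaf.germ_res_apply (homOfLE hW) _ htW]
  refine (congrArg _ hWI).trans (map_zero _)

/-- Used in contrapositive form: in multiplicity `> 1` the ideal of `Y` is nonzero on every affine
open subset meeting `Y`. -/
lemma hasMultiplicityOne_of_ideal_eq_bot {Y : Closeds X} {V : X.affineOpens}
    (h : (Scheme.IdealSheafData.vanishingIdeal Y).ideal V = ⊥) {p : X} (hp : p ∈ Y)
    (hpV : p ∈ V.1) : HasMultiplicityOne Y := by
  have hp' : p ∈ (Y : Set X) := hp
  rw [← range_reducedι] at hp'
  obtain ⟨t, rfl⟩ := hp'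
  exact ⟨reducedι Y ⁻¹ᵁ V.1, ⟨t, hpV⟩, fun x hx ↦ bijective_stalkMap_of_ideal_eq_bot h x hx⟩

/-- The ideal sheaf of a closed subscheme is free off the subscheme. -/
lemma isLocallyFreeAt_of_notMem_range {Z : Scheme.{u}} (f : Z ⟶ X) [IsClosedImmersion f] {p : X}
    (hp : p ∉ Set.range f) : IsLocallyFreeAt (idealModule f) p := by
  let U : X.Opens := ⟨(Set.range f)ᶜ, f.isClosedEmbedding.isClosed_range.isOpen_compl⟩
  refine isLocallyFreeAt_idealModule f (U := U) 1 ?_ (fun V hV ↦ ⟨?_, ?_⟩) hp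
  · have h : f ⁻¹ᵁ U = ⊥ := by
      refine eq_bot_iff.2 fun z hz ↦ (hz ⟨z, rfl⟩).elim
    have : Subsingleton Γ(Z, f ⁻¹ᵁ U) := by rw [h]; infer_instance
    exact Subsingleton.elim _ _
  · rw [map_one]; exact one_mem _
  · rw [map_one, Ideal.span_singleton_one]; exact le_top

end Reduced

/-! ### Divisors on `Y` and freeness at their points -/

section Divisor
variable {X : Scheme.{u}} {Y : Closeds X}

lemma range_divisorι (C : (reducedScheme Y).IdealSheafData) :
    Set.range (divisorι Y C) = reducedι Y '' C.support := by
  rw [Scheme.Hom.comp_base, TopCat.coe_comp, Set.range_comp, C.range_subschemeι]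

lemma range_divisorι_subset (C : (reducedScheme Y).IdealSheafData) :
    Set.range (divisorι Y C) ⊆ Y := by
  rw [range_divisorι]
  rintro _ ⟨t, -, rfl⟩
  exact reducedι_mem Y t

lemma eq_of_range_divisorι_eq {C₁ C₂ : (reducedScheme Y).IdealSheafData}
    [IsReduced C₁.subscheme] [IsReduced C₂.subscheme]
    (h : Set.range (divisorι Y C₁) = Set.range (divisorι Y C₂)) : C₁ = C₂ := by
  rw [range_divisorι, range_divisorι] at h
  exact eq_of_support_eq (SetLike.coe_injective
    ((reducedι Y).isEmbedding.injective.image_injective h))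

lemma ker_divisorι_app (C : (reducedScheme Y).IdealSheafData) (V : X.affineOpens) :
    RingHom.ker ((divisorι Y C).app V.1).hom =
      (C.ideal ⟨_, V.2.preimage (reducedι Y)⟩).comap ((reducedι Y).app V.1).hom := by
  rw [← Scheme.IdealSheafData.ideal_map_of_isAffineHom, Scheme.IdealSheafData.map,
    ← Scheme.Hom.ker_apply]

lemma nonLocallyFreeLocus_subset_range (C : (reducedScheme Y).IdealSheafData) :
    nonLocallyFreeLocus Y C ⊆ Set.range (divisorι Y C) := by
  intro p hp
  by_contra h
  exact hp.2 (isLocallyFreeAt_of_notMem_range _ h)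

lemma nonLocallyFreeLocus_eq_of_iso {C₁ C₂ : (reducedScheme Y).IdealSheafData}
    (e : idealModule (divisorι Y C₁) ≅ idealModule (divisorι Y C₂)) :
    nonLocallyFreeLocus Y C₁ = nonLocallyFreeLocus Y C₂ := by
  ext p
  exact and_congr_right fun _ ↦ not_congr ⟨fun h ↦ h.of_iso e, fun h ↦ h.of_iso e.symm⟩

variable {k : Type u} [Field k] {N : ℕ}

/-- On an integral scheme a section that vanishes on a non-empty open subset vanishes on the whole
chart. For `e > 0` the gluing relation gives `s_j` as a multiple of `s_l` on the overlap, which is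
non-empty as soon as both charts are, so the zero spreads to every chart. -/
lemma res_section_ne_zero {T : Scheme.{u}} [IsIntegral T] (f : T ⟶ ProjSpace k N) {e : ℤ}
    (he : 0 < e) {s : twistSections f (structureModule T) e ⊤} (hs : s ≠ 0) (l : Fin (N + 1))
    {V : T.Opens} (h : V ≤ ⊤ ⊓ chart f l) (hne : ∃ x, x ∈ V) :
    (T.presheaf.map (homOfLE h).op).hom (s.1 l : Γ(T, ⊤ ⊓ chart f l)) ≠ 0 := by
  intro h0
  have hV : Nonempty V := hne.elim fun x hx ↦ ⟨⟨x, hx⟩⟩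
  have hl : (s.1 l : Γ(T, ⊤ ⊓ chart f l)) = 0 :=
    map_injective_of_isIntegral T (homOfLE h) (h0.trans (map_zero _).symm)
  refine hs (Subtype.ext (funext fun j ↦ ?_))
  by_cases hj : ∃ x, x ∈ chart f j
  · obtain ⟨x, hx⟩ := hj
    obtain ⟨y, hy⟩ := hne
    obtain ⟨z, -, hzj, hzl⟩ := (PreirreducibleSpace.isPreirreducible_univ (X := T)) _ _
      (chart f j).2 (chart f l).2 ⟨x, trivial, hx⟩ ⟨y, trivial, (h hy).2⟩
    have : Nonempty (⊤ ⊓ (chart f j ⊓ chart f l) : T.Opens) := ⟨⟨z, trivial, hzj, hzl⟩⟩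
    have rel := s.2 j l
    have hl' : s.1 l = 0 := hl
    rw [show (-e).toNat = 0 by omega, pow_zero, one_smul, hl', map_zero, smul_zero] at rel
    exact map_injective_of_isIntegral T
      (homOfLE (inf_le_inf_left ⊤ inf_le_left : ⊤ ⊓ (chart f j ⊓ chart f l) ≤ ⊤ ⊓ chart f j))
      (rel.symm.trans (map_zero _).symm)
  · have h : ⊤ ⊓ chart f j = ⊥ := eq_bot_iff.2 fun x hx ↦ hj ⟨x, hx.2⟩
    have : Subsingleton Γ(T, ⊤ ⊓ chart f j) := by rw [h]; infer_instance
    exact Subsingleton.elim (α := Γ(T, ⊤ ⊓ chart f j)) _ _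

lemma isPrime_vanishingIdeal (hY : IsIrreducible (Y : Set X)) (V : X.affineOpens)
    {p : X} (hp : p ∈ Y) (hpV : p ∈ V.1) :
    ((Scheme.IdealSheafData.vanishingIdeal Y).ideal V).IsPrime := by
  have := isIntegral_reducedScheme hY
  have hp' : p ∈ (Y : Set X) := hp
  rw [← range_reducedι] at hp'
  obtain ⟨t, rfl⟩ := hp'
  have : Nonempty (reducedι Y ⁻¹ᵁ V.1 : (reducedScheme Y).Opens) := ⟨⟨t, hpV⟩⟩
  rw [← Scheme.IdealSheafData.ker_subschemeι_app]
  exact RingHom.ker_isPrime _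

/-- If the ideal sheaf of `C` is locally free at a point of `C`, then `X` is reduced and
coincides with `Y` near this point. -/
lemma exists_ideal_eq_bot_of_isLocallyFreeAt [IsLocallyNoetherian X] (i : X ⟶ ProjSpace k N)
    (hY : IsIrreducible (Y : Set X)) {e : ℤ} (he : 0 < e) {C : (reducedScheme Y).IdealSheafData}
    (hC : MemLinearSystem (reducedι Y ≫ i) e C) {p : X} (hp : p ∈ Set.range (divisorι Y C))
    (h : IsLocallyFreeAt (idealModule (divisorι Y C)) p) :
    ∃ V : X.affineOpens, p ∈ V.1 ∧ (Scheme.IdealSheafData.vanishingIdeal Y).ideal V = ⊥ := by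
  have := isIntegral_reducedScheme hY
  obtain ⟨c, rfl⟩ := hp
  obtain ⟨s, hs, hsC⟩ := hC
  obtain ⟨U, hpU, r, hU⟩ := exists_linearEquiv_of_isLocallyFreeAt h
  obtain ⟨l, hl⟩ := exists_mem_chart i (divisorι Y C c)
  obtain ⟨V, hpV, hVU⟩ := exists_affineOpens_le (U := U ⊓ chart i l) ⟨hpU, hl⟩
  obtain ⟨e₁⟩ := hU V.1 (hVU.trans inf_le_left)
  let V' : (reducedScheme Y).affineOpens := ⟨_, V.2.preimage (reducedι Y)⟩
  have hV' : V'.1 ≤ ⊤ ⊓ chart (reducedι Y ≫ i) l := fun x hx ↦ ⟨trivial, (hVU hx).2⟩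
  have hpY : divisorι Y C c ∈ Y := range_divisorι_subset C ⟨c, rfl⟩
  let P := (Scheme.IdealSheafData.vanishingIdeal Y).ideal V
  have hPdef : P = RingHom.ker ((reducedι Y).app V.1).hom :=
    ((Scheme.IdealSheafData.vanishingIdeal Y).ker_subschemeι_app V).symm
  have hP : P.IsPrime := isPrime_vanishingIdeal hY V hpY hpV
  let I := RingHom.ker ((divisorι Y C).app V.1).hom
  have hI : I = (C.ideal V').comap ((reducedι Y).app V.1).hom := ker_divisorι_app C V
  have hPI : P ≤ I := by
    rw [hI, hPdef]
    intro x hx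
    rw [Ideal.mem_comap, RingHom.mem_ker.1 hx]
    exact zero_mem _
  -- A lift `g` to `X` of the section defining `C` lies in `I` but not in `P`, so the inclusion of
  -- `P` in `I` is strict.
  obtain ⟨g, hg⟩ := (Scheme.IdealSheafData.vanishingIdeal Y).subschemeι_app_surjective V
    ((reducedScheme Y).presheaf.map (homOfLE hV').op
      (s.1 l : Γ(reducedScheme Y, ⊤ ⊓ chart (reducedι Y ≫ i) l)))
  have hgI : g ∈ I := by
    rw [hI, Ideal.mem_comap, hsC l V' hV']
    exact Ideal.mem_span_singleton.2 (Dvd.intro_left 1 (by rw [one_mul]; exact hg.symm))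
  have hgP : g ∉ P := by
    rw [hPdef]
    intro hg'
    exact res_section_ne_zero (reducedι Y ≫ i) he hs l hV' ⟨C.subschemeι c, hpV⟩
      (hg.symm.trans hg')
  have hIP : ¬ I ≤ P := fun hle ↦ hgP (hle hgI)
  have hIne : I ≠ ⊥ := fun h0 ↦ hIP (h0 ▸ bot_le)
  obtain ⟨f, hf⟩ := exists_eq_span_singleton_of_linearEquiv I hIne
    (e₁.trans (idealSectionsEquiv (divisorι Y C) V.1))
  have : IsNoetherianRing Γ(X, V.1) := IsLocallyNoetherian.component_noetherian V
  obtain ⟨a, ha, haP⟩ := exists_smul_eq_zero_of_lt_span_singleton P I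
    (IsNoetherian.noetherian P) hf hPI hIP
  refine ⟨X.affineBasicOpen a, ?_, ?_⟩
  · have h1 : (divisorι Y C).app V.1 a = 1 := by
      have := RingHom.mem_ker.1 ha
      rwa [map_sub, map_one, sub_eq_zero] at this
    have h2 := Scheme.preimage_basicOpen (divisorι Y C) a
    rw [h1, Scheme.basicOpen_one] at h2
    exact h2.ge hpV
  · refine ((Scheme.IdealSheafData.map_ideal_basicOpen _ V a).symm.trans
      (eq_bot_iff.2 (Ideal.map_le_iff_le_comap.2 fun x hx ↦ Ideal.mem_bot.2 ?_)))
    have hu : IsUnit ((X.presheaf.map (homOfLE (X.basicOpen_le a)).op).hom a) :=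
      RingedSpace.isUnit_res_basicOpen _ a
    refine hu.mul_right_eq_zero.1 ?_
    rw [← map_mul, haP x hx, map_zero]

end Divisor
end
end ACM

namespace ACM
noncomputable section

/-! ### Multiplicity one: where `X` coincides with `Y` -/

section MultiplicityOne
variable {X : Scheme.{u}} {Y : Closeds X}

/-- On a Cohen–Macaulay scheme, the annihilator of a nonzero function on an affine open subset is
contained in a minimal prime ideal. -/
lemma exists_minimalPrimes_of_isCohenMacaulay [IsLocallyNoetherian X] (hCM : IsCohenMacaulay X)
    (V : X.affineOpens) {x : Γ(X, V.1)} (hx : x ≠ 0) :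
    ∃ Q ∈ minimalPrimes Γ(X, V.1), ∀ a, a * x = 0 → a ∈ Q := by
  have : IsNoetherianRing Γ(X, V.1) := IsLocallyNoetherian.component_noetherian V
  -- The annihilator of `x` lies in an associated prime `Q = Ann(y)`. In the local ring at `Q` the
  -- maximal ideal kills the nonzero image of `y`, so the depth is zero, hence so is the dimension,
  -- and `Q` is minimal.
  obtain ⟨Q, hQ, hle⟩ := exists_le_isAssociatedPrime_of_isNoetherianRing Γ(X, V.1) x hx
  refine ⟨Q, ?_, fun a ha ↦ hle (Submodule.mem_colon_singleton.2 ha)⟩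
  have hQp := hQ.isPrime
  obtain ⟨y, hy⟩ : ∃ y : Γ(X, V.1), ∀ a, a ∈ Q ↔ a * y = 0 := by
    obtain ⟨-, y, hy⟩ := isAssociatedPrime_iff.1 hQ
    exact ⟨y, fun a ↦ by rw [hy, Submodule.mem_colon_singleton]; rfl⟩
  let q : PrimeSpectrum Γ(X, V.1) := ⟨Q, hQp⟩
  let z : V.1 := ⟨V.2.fromSpec q, V.2.range_fromSpec.subset ⟨q, rfl⟩⟩
  let := (X.presheaf.germ V.1 _ z.2).hom.toAlgebra
  have hloc : IsLocalization.AtPrime (X.presheaf.stalk z.1) Q :=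
    V.2.isLocalization_stalk' q z.2
  have hy0 : algebraMap Γ(X, V.1) (X.presheaf.stalk z.1) y ≠ 0 := by
    intro h
    obtain ⟨m, hm⟩ := (IsLocalization.map_eq_zero_iff Q.primeCompl (X.presheaf.stalk z.1) y).1 h
    exact m.2 ((hy m.1).2 hm)
  have hd : depth (X.presheaf.stalk z.1) = 0 := by
    refine depth_eq_zero_of_annihilator hy0 fun r hr ↦ ?_
    obtain ⟨a, m, rfl⟩ := IsLocalization.exists_mk'_eq Q.primeCompl r
    have ha : a ∈ Q := by
      by_contra ha
      have hu : IsUnit (IsLocalization.mk' (X.presheaf.stalk z.1) a m) :=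
        (IsLocalization.AtPrime.isUnit_mk'_iff _ Q a m).2 ha
      exact (IsLocalRing.mem_maximalIdeal _).1 hr hu
    rw [← IsLocalization.mk'_one (M := Q.primeCompl) (X.presheaf.stalk z.1) y,
      ← IsLocalization.mk'_mul, (hy a).1 ha, IsLocalization.mk'_zero]
  have h1 := hCM z.1
  rw [hd, IsLocalization.AtPrime.ringKrullDim_eq_height Q] at h1
  rw [← Ideal.height_eq_zero_iff]
  exact_mod_cast h1.symm

lemma mem_asIdeal_of_mem_vanishingIdeal {V : X.affineOpens} (q : PrimeSpectrum Γ(X, V.1))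
    (hq : V.2.fromSpec q ∈ Y) {x : Γ(X, V.1)}
    (hx : x ∈ (Scheme.IdealSheafData.vanishingIdeal Y).ideal V) : x ∈ q.asIdeal := by
  rw [Scheme.IdealSheafData.vanishingIdeal_ideal, PrimeSpectrum.mem_vanishingIdeal] at hx
  exact hx q hq

/-- If `Y` has multiplicity one, then functions vanishing on `Y` are killed by functions not
vanishing on `Y`. -/
lemma exists_mul_eq_zero_of_hasMultiplicityOne (hY : IsIrreducible (Y : Set X))
    (hm : HasMultiplicityOne Y) {V : X.affineOpens} {p : X} (hp : p ∈ Y) (hpV : p ∈ V.1)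
    {x : Γ(X, V.1)} (hx : x ∈ (Scheme.IdealSheafData.vanishingIdeal Y).ideal V) :
    ∃ m ∉ (Scheme.IdealSheafData.vanishingIdeal Y).ideal V, m * x = 0 := by
  have := isIntegral_reducedScheme hY
  obtain ⟨U, ⟨t₁, ht₁⟩, hU⟩ := hm
  have hp' : p ∈ (Y : Set X) := hp
  rw [← range_reducedι] at hp'
  obtain ⟨t₂, rfl⟩ := hp'
  -- The open set given by multiplicity one need not contain `p`; irreducibility of `Y` provides a
  -- point of it inside `V`.
  obtain ⟨t, -, htU, htV⟩ := (PreirreducibleSpace.isPreirreducible_univ (X := reducedScheme Y)) _ _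
    U.2 (reducedι Y ⁻¹ᵁ V.1).2 ⟨t₁, trivial, ht₁⟩ ⟨t₂, trivial, hpV⟩
  have htV' : reducedι Y t ∈ V.1 := htV
  have h0 : X.presheaf.germ V.1 _ htV' x = 0 := by
    refine (injective_iff_map_eq_zero _).1 (hU t htU).1 _ ?_
    refine ((reducedι Y).germ_stalkMap_apply V.1 t htV' x).trans ?_
    rw [← Scheme.IdealSheafData.ker_subschemeι_app, RingHom.mem_ker] at hx
    exact (congrArg _ hx).trans (map_zero _)
  let q := V.2.primeIdealOf ⟨_, htV'⟩
  let := (X.presheaf.germ V.1 _ htV').hom.toAlgebra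
  have hloc : IsLocalization.AtPrime (X.presheaf.stalk (reducedι Y t)) q.asIdeal :=
    V.2.isLocalization_stalk ⟨_, htV'⟩
  obtain ⟨m, hm⟩ := (IsLocalization.map_eq_zero_iff q.asIdeal.primeCompl
    (X.presheaf.stalk (reducedι Y t)) x).1 h0
  refine ⟨m.1, fun h ↦ m.2 (mem_asIdeal_of_mem_vanishingIdeal q ?_ h), hm⟩
  rw [V.2.fromSpec_primeIdealOf]
  exact reducedι_mem Y t

/-- Where `Y` has multiplicity one and is the only component, `X` coincides with `Y`. -/
lemma ideal_eq_bot_of_subset [IsLocallyNoetherian X] (hCM : IsCohenMacaulay X)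
    (hY : IsIrreducible (Y : Set X)) (hm : HasMultiplicityOne Y) {V : X.affineOpens}
    (hV : (V.1 : Set X) ⊆ Y) : (Scheme.IdealSheafData.vanishingIdeal Y).ideal V = ⊥ := by
  rw [eq_bot_iff]
  intro x hx
  by_contra hx0
  have hx0 : x ≠ 0 := hx0
  obtain ⟨p, hp⟩ : ∃ p, p ∈ V.1 := by
    by_contra h
    have hb : V.1 = ⊥ := eq_bot_iff.2 fun p hp ↦ (h ⟨p, hp⟩).elim
    have : Subsingleton Γ(X, V.1) := by rw [hb]; infer_instance
    exact hx0 (Subsingleton.elim _ _)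
  -- Since `V ⊆ Y`, the minimal prime `Q` contains the prime ideal of `Y`, hence equals it; but `m`
  -- kills `x`, so lies in `Q`, and does not vanish on `Y`.
  obtain ⟨Q, hQ, hQx⟩ := exists_minimalPrimes_of_isCohenMacaulay hCM V hx0
  obtain ⟨m, hmP, hmx⟩ := exists_mul_eq_zero_of_hasMultiplicityOne hY hm (hV hp) hp hx
  have hP := isPrime_vanishingIdeal hY V (hV hp) hp
  have hQp : Q.IsPrime := hQ.1.1
  have hPQ : (Scheme.IdealSheafData.vanishingIdeal Y).ideal V ≤ Q := fun y hy ↦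
    mem_asIdeal_of_mem_vanishingIdeal ⟨Q, hQp⟩ (hV (V.2.range_fromSpec.subset ⟨_, rfl⟩)) hy
  exact hmP (hQ.2 ⟨hP, bot_le⟩ hPQ (hQx m hmx))

lemma isIntegral_of_eq_univ [IsLocallyNoetherian X] (hCM : IsCohenMacaulay X)
    (hY : IsIrreducible (Y : Set X)) (hm : HasMultiplicityOne Y) (h : (Y : Set X) = Set.univ) :
    IsIntegral X := by
  have hb : Scheme.IdealSheafData.vanishingIdeal Y = ⊥ := by
    ext V : 2
    exact ideal_eq_bot_of_subset hCM hY hm (h ▸ Set.subset_univ _)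
  have hI := isIntegral_reducedScheme hY
  have : IsIso (reducedι Y) := (Scheme.isIso_subschemeι_iff_eq_bot _).2 hb
  obtain ⟨t⟩ : Nonempty (reducedScheme Y) := inferInstance
  have : Nonempty X := ⟨reducedι Y t⟩
  exact isIntegral_of_isOpenImmersion (inv (reducedι Y))

lemma subset_of_ideal_eq_bot {V : X.affineOpens}
    (h : (Scheme.IdealSheafData.vanishingIdeal Y).ideal V = ⊥) : (V.1 : Set X) ⊆ Y := by
  intro x hx
  have : x ∈ (Scheme.IdealSheafData.vanishingIdeal Y).support := by
    rw [Scheme.IdealSheafData.mem_support_iff_of_mem (U := V) hx, h]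
    simp
  have h2 : x ∈ ((Scheme.IdealSheafData.vanishingIdeal Y).support : Set X) := this
  rwa [Scheme.IdealSheafData.coe_support_vanishingIdeal] at h2

/-- The inclusion of `X ∖ Y` is quasi-compact, so its scheme-theoretic closure has the topological
closure as support; multiplicities play no role for the underlying set. -/
lemma coe_support_residualIntersection [IsNoetherian X] :
    ((residualIntersection Y).support : Set X) = (Y : Set X) ∩ closure (Y : Set X)ᶜ := by
  rw [residualIntersection, Scheme.IdealSheafData.support_sup, Closeds.coe_inf,
    Scheme.IdealSheafData.coe_support_vanishingIdeal, Scheme.Hom.support_ker,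
    Scheme.Opens.range_ι]
  rfl

variable {k : Type u} [Field k] {N : ℕ}

/-- Away from the other components, the ideal sheaf of `C` is generated by the section that
defines `C`. -/
lemma isLocallyFreeAt_of_notMem_closure_compl [IsLocallyNoetherian X] (i : X ⟶ ProjSpace k N)
    (hCM : IsCohenMacaulay X) (hY : IsIrreducible (Y : Set X)) (hm : HasMultiplicityOne Y) {e : ℤ}
    (he : 0 < e) {C : (reducedScheme Y).IdealSheafData}
    (hC : MemLinearSystem (reducedι Y ≫ i) e C) {p : X} (hp : p ∉ closure (Y : Set X)ᶜ) :
    IsLocallyFreeAt (idealModule (divisorι Y C)) p := by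
  have := isIntegral_reducedScheme hY
  obtain ⟨s, hs, hsC⟩ := hC
  obtain ⟨l, hl⟩ := exists_mem_chart i p
  obtain ⟨V, hpV, hVU⟩ := exists_affineOpens_le
    (U := ⟨(closure (Y : Set X)ᶜ)ᶜ, isClosed_closure.isOpen_compl⟩ ⊓ chart i l) ⟨hp, hl⟩
  have hVY : (V.1 : Set X) ⊆ Y := fun x hx ↦ by
    by_contra h
    exact (hVU hx).1 (subset_closure h)
  have hbot : (Scheme.IdealSheafData.vanishingIdeal Y).ideal V = ⊥ :=
    ideal_eq_bot_of_subset hCM hY hm hVY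
  have hW' (W : X.affineOpens) (hW : W.1 ≤ V.1) :
      reducedι Y ⁻¹ᵁ W.1 ≤ ⊤ ⊓ chart (reducedι Y ≫ i) l :=
    fun x hx ↦ ⟨trivial, (hVU (hW hx)).2⟩
  obtain ⟨g, hg⟩ := (Scheme.IdealSheafData.vanishingIdeal Y).subschemeι_app_surjective V
    ((reducedScheme Y).presheaf.map (homOfLE (hW' V le_rfl)).op
      (s.1 l : Γ(reducedScheme Y, ⊤ ⊓ chart (reducedι Y ≫ i) l)))
  have hgW (W : X.affineOpens) (hW : W.1 ≤ V.1) :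
      (reducedι Y).app W.1 ((X.presheaf.map (homOfLE hW).op).hom g) =
        (reducedScheme Y).presheaf.map (homOfLE (hW' W hW)).op
          (s.1 l : Γ(reducedScheme Y, ⊤ ⊓ chart (reducedι Y ≫ i) l)) := by
    refine (ConcreteCategory.congr_hom ((reducedι Y).naturality (homOfLE hW).op) g).trans ?_
    refine (congrArg ((reducedScheme Y).presheaf.map
      (homOfLE (fun x hx ↦ hW hx : reducedι Y ⁻¹ᵁ W.1 ≤ reducedι Y ⁻¹ᵁ V.1)).op) hg).trans ?_
    exact ConcreteCategory.congr_hom ((reducedScheme Y).presheaf.map_comp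
      (homOfLE (hW' V le_rfl)).op (homOfLE (fun x hx ↦ hW hx : reducedι Y ⁻¹ᵁ W.1 ≤ _)).op).symm _
  have hker (W : X.affineOpens) (hW : W.1 ≤ V.1) :
      RingHom.ker ((divisorι Y C).app W.1).hom =
        (Ideal.span {(reducedι Y).app W.1 ((X.presheaf.map (homOfLE hW).op).hom g)}).comap
          ((reducedι Y).app W.1).hom := by
    rw [ker_divisorι_app, hsC l _ (hW' W hW), hgW]
  have hinj (W : X.affineOpens) (hW : W.1 ≤ V.1) :
      Function.Injective ((reducedι Y).app W.1).hom := by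
    rw [RingHom.injective_iff_ker_eq_bot, Scheme.IdealSheafData.ker_subschemeι_app]
    exact ideal_eq_bot_of_le hbot hW
  refine isLocallyFreeAt_idealModule _ (U := V.1) g ?_ (fun W hW ↦ ⟨?_, ?_⟩) hpV
  · have : g ∈ RingHom.ker ((divisorι Y C).app V.1).hom := by
      rw [ker_divisorι_app, hsC l _ (hW' V le_rfl), Ideal.mem_comap]
      exact Ideal.mem_span_singleton.2 (Dvd.intro_left 1 (by rw [one_mul]; exact hg.symm))
    exact this
  · by_cases hne : ∃ x, x ∈ W.1
    · obtain ⟨x, hx⟩ := hne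
      have hxY : x ∈ (Y : Set X) := hVY (hW hx)
      rw [← range_reducedι] at hxY
      obtain ⟨t, rfl⟩ := hxY
      have : Nonempty (reducedι Y ⁻¹ᵁ W.1 : (reducedScheme Y).Opens) := ⟨⟨t, hx⟩⟩
      have : IsDomain Γ(X, W.1) := (hinj W hW).isDomain _
      refine mem_nonZeroDivisors_of_ne_zero fun h0 ↦ ?_
      refine res_section_ne_zero (reducedι Y ≫ i) he hs l (hW' W hW) ⟨t, hx⟩ ?_
      refine (hgW W hW).symm.trans ?_
      rw [h0, map_zero]
    · have hb : W.1 = ⊥ := eq_bot_iff.2 fun p hp ↦ (hne ⟨p, hp⟩).elim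
      have : Subsingleton Γ(X, W.1) := by rw [hb]; infer_instance
      rw [Subsingleton.elim ((X.presheaf.map (homOfLE hW).op).hom g) 1]
      exact one_mem _
  · rw [hker W hW]
    intro x hx
    obtain ⟨b, hb⟩ := Ideal.mem_span_singleton'.1 (Ideal.mem_comap.1 hx)
    obtain ⟨a, rfl⟩ := (Scheme.IdealSheafData.vanishingIdeal Y).subschemeι_app_surjective W b
    refine Ideal.mem_span_singleton'.2 ⟨a, hinj W hW ?_⟩
    rw [map_mul]
    exact hb

/-- Freeness at a point of `C` would give a neighbourhood contained in `Y`, which cannot exist at a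
point of the closure of `X ∖ Y`. -/
lemma nonLocallyFreeLocus_eq [IsNoetherian X] (i : X ⟶ ProjSpace k N)
    (hCM : IsCohenMacaulay X) (hY : IsIrreducible (Y : Set X)) (hm : HasMultiplicityOne Y) {e : ℤ}
    (he : 0 < e) {C : (reducedScheme Y).IdealSheafData}
    (hC : MemLinearSystem (reducedι Y ≫ i) e C) :
    nonLocallyFreeLocus Y C =
      ((residualIntersection Y).support : Set X) ∩ Set.range (divisorι Y C) := by
  rw [coe_support_residualIntersection]
  ext p
  constructor
  · intro hp
    refine ⟨⟨hp.1, ?_⟩, nonLocallyFreeLocus_subset_range C hp⟩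
    by_contra h
    exact hp.2 (isLocallyFreeAt_of_notMem_closure_compl i hCM hY hm he hC h)
  · rintro ⟨⟨hpY, hp⟩, hpC⟩
    refine ⟨hpY, fun hfree ↦ ?_⟩
    obtain ⟨V, hpV, hV⟩ := exists_ideal_eq_bot_of_isLocallyFreeAt i hY he hC hpC hfree
    obtain ⟨z, hzV, hz⟩ := mem_closure_iff.1 hp _ V.1.2 hpV
    exact hz (subset_of_ideal_eq_bot hV hzV)

end MultiplicityOne
end
end ACM

namespace ACM
noncomputable section

/-! ### Irreducible components of a noetherian space -/

section Components
variable {T : Type u} [TopologicalSpace T] [NoetherianSpace T] {Y : Set T}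

/-- The components other than `Y` are finite in number, so their union is closed, and it contains
the complement of `Y`. -/
lemma exists_irreducibleComponent_of_mem_closure_compl {x : T} (hx : x ∈ closure Yᶜ) :
    ∃ W ∈ irreducibleComponents T, W ≠ Y ∧ x ∈ W := by
  have hfin : Set.Finite (irreducibleComponents T \ {Y}) :=
    NoetherianSpace.finite_irreducibleComponents.subset Set.sdiff_subset
  have hcl : IsClosed (⋃₀ (irreducibleComponents T \ {Y})) :=
    Set.sUnion_eq_biUnion ▸ hfin.isClosed_biUnion fun W hW ↦
      isClosed_of_mem_irreducibleComponents W hW.1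
  have hle : Yᶜ ⊆ ⋃₀ (irreducibleComponents T \ {Y}) := by
    intro z hz
    have : z ∈ ⋃₀ irreducibleComponents T := by
      rw [sUnion_irreducibleComponents]; trivial
    obtain ⟨W, hW, hzW⟩ := this
    refine ⟨W, ⟨hW, fun h ↦ hz (h ▸ hzW)⟩, hzW⟩
  obtain ⟨W, hW, hxW⟩ := closure_minimal hle hcl hx
  exact ⟨W, hW.1, hW.2, hxW⟩

lemma exists_specializes_notMem [QuasiSober T] (hY : Y ∈ irreducibleComponents T) {x : T}
    (hx : x ∈ closure Yᶜ) : ∃ y, y ⤳ x ∧ y ∉ Y := by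
  obtain ⟨W, hW, hne, hxW⟩ := exists_irreducibleComponent_of_mem_closure_compl hx
  obtain ⟨y, hy⟩ := QuasiSober.sober hW.1 (isClosed_of_mem_irreducibleComponents W hW)
  refine ⟨y, hy.specializes hxW, fun hyY ↦ hne ?_⟩
  have hle : W ⊆ Y := by
    rw [← hy.def]
    exact closure_minimal (Set.singleton_subset_iff.2 hyY)
      (isClosed_of_mem_irreducibleComponents Y hY)
  exact hle.antisymm (hW.2 hY.1 hle)

lemma notMem_closure_compl_of_isGenericPoint (hY : Y ∈ irreducibleComponents T) {y : T}
    (hy : IsGenericPoint y Y) : y ∉ closure Yᶜ := by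
  intro h
  obtain ⟨W, hW, hne, hyW⟩ := exists_irreducibleComponent_of_mem_closure_compl h
  have hle : Y ⊆ W := by
    rw [← hy.def]
    exact closure_minimal (Set.singleton_subset_iff.2 hyW)
      (isClosed_of_mem_irreducibleComponents W hW)
  exact hne (hle.antisymm (hY.2 hW.1 hle)).symm

end Components

/-! ### Codimension and non-emptiness of `F` -/

section Residual
variable {X : Scheme.{u}} {Y : Closeds X}

/-- The local ring of a Cohen–Macaulay scheme at a generic point of the intersection of a
component with the union of the others has dimension at most one. -/
lemma ringKrullDim_stalk_le_one [IsNoetherian X] (hCM : IsCohenMacaulay X)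
    (hY : (Y : Set X) ∈ irreducibleComponents X) {x : X}
    (hx : x ∈ (Y : Set X) ∩ closure (Y : Set X)ᶜ)
    (hgen : ∀ y ∈ (Y : Set X) ∩ closure (Y : Set X)ᶜ, y ⤳ x → y = x) :
    ringKrullDim (X.presheaf.stalk x) ≤ 1 := by
  rw [← hCM x]
  by_contra hlt
  have h2 : 2 ≤ depth (X.presheaf.stalk x) := by
    have h1 : ¬ depth (X.presheaf.stalk x) ≤ 1 := fun h ↦ hlt (by exact_mod_cast h)
    rw [not_le] at h1
    exact Order.add_one_le_of_lt h1
  -- The spectrum of the stalk consists of the generizations of `x`. The traces of `Y` and of the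
  -- closure of its complement cover it and, by `hgen`, meet only in the closed point. Neither is
  -- everything, because of the generic points of `Y` and of another component through `x`.
  let φ := X.fromSpecStalk x
  have hinj : Function.Injective φ := φ.isEmbedding.injective
  have hr (y : X) (hy : y ⤳ x) : ∃ q, φ q = y := by
    have : y ∈ Set.range φ := by rw [Scheme.range_fromSpecStalk]; exact hy
    exact this
  have hcl : φ (IsLocalRing.closedPoint _) = x := Scheme.fromSpecStalk_closedPoint
  have hr' (q) : φ q ⤳ x := by
    have : φ q ∈ Set.range φ := ⟨q, rfl⟩
    rwa [Scheme.range_fromSpecStalk] at this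
  rcases eq_univ_or_eq_univ_of_two_le_depth h2 (S := φ ⁻¹' Y) (T := φ ⁻¹' closure (Y : Set X)ᶜ)
    (Y.isClosed.preimage φ.continuous) (isClosed_closure.preimage φ.continuous)
    (Set.eq_univ_of_forall fun q ↦ by
      by_cases h : φ q ∈ (Y : Set X)
      · exact Or.inl h
      · exact Or.inr (subset_closure h))
    (fun q hq ↦ hinj ((hgen _ hq (hr' q)).trans hcl.symm)) with h | h
  · obtain ⟨y, hyx, hyY⟩ := exists_specializes_notMem hY hx.2
    obtain ⟨q, rfl⟩ := hr y hyx
    exact hyY (h.ge (Set.mem_univ q))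
  · obtain ⟨y, hy⟩ := QuasiSober.sober hY.1 Y.isClosed
    obtain ⟨q, rfl⟩ := hr y (hy.specializes hx.1)
    exact notMem_closure_compl_of_isGenericPoint hY hy (h.ge (Set.mem_univ q))

/-- The components of the intersection of a component with the union of the others have
codimension one. -/
lemma topologicalKrullDim_add_one_eq {k : Type u} [Field k] (f : X ⟶ Spec (.of k))
    [LocallyOfFiniteType f] [IsNoetherian X]
    (hCM : IsCohenMacaulay X) (hY : (Y : Set X) ∈ irreducibleComponents X) {W : Set X}
    (hW : Maximal (fun S ↦ IsIrreducible S ∧ S ⊆ (Y : Set X) ∩ closure (Y : Set X)ᶜ) W) :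
    topologicalKrullDim W + 1 = topologicalKrullDim (Y : Set X) := by
  have hWcl : IsClosed W := by
    have : closure W ⊆ W := hW.2 ⟨hW.1.1.closure,
      closure_minimal hW.1.2 (Y.isClosed.inter isClosed_closure)⟩ subset_closure
    exact isClosed_of_closure_subset this
  obtain ⟨x, hx⟩ := QuasiSober.sober hW.1.1 hWcl
  have hxF := hW.1.2 hx.mem
  -- Maximality of `W` says that no other point of `F` specializes to its generic point `x`.
  have hd := ringKrullDim_stalk_le_one hCM hY hxF fun y hy hyx ↦ by
    have h1 : W ⊆ closure {y} := by
      rw [← hx.def]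
      exact closure_minimal (Set.singleton_subset_iff.2 (specializes_iff_mem_closure.1 hyx))
        isClosed_closure
    have h2 : closure {y} ⊆ W := hW.2 ⟨isIrreducible_singleton.closure,
      closure_minimal (Set.singleton_subset_iff.2 hy) (Y.isClosed.inter isClosed_closure)⟩ h1
    exact IsGenericPoint.eq (h2.antisymm h1) hx
  have hI := isIntegral_reducedScheme hY.1
  have hxY : x ∈ (Y : Set X) := hxF.1
  rw [← range_reducedι] at hxY
  obtain ⟨t, rfl⟩ := hxY
  have hd' : ringKrullDim ((reducedScheme Y).presheaf.stalk t) ≤ 1 :=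
    (ringKrullDim_le_of_surjective _ ((reducedι Y).stalkMap_surjective t)).trans hd
  have hle := topologicalKrullDim_le_closure_add_one (reducedι Y ≫ f) t hd'
  have hemb := (reducedι Y).isClosedEmbedding
  have e₁ : topologicalKrullDim (closure {t} : Set (reducedScheme Y)) = topologicalKrullDim W := by
    rw [IsHomeomorph.topologicalKrullDim_eq _
      (hemb.isEmbedding.homeomorphImage (closure {t})).isHomeomorph,
      ← hemb.closure_image_eq, Set.image_singleton, hx.def]
  have e₂ : topologicalKrullDim (reducedScheme Y) = topologicalKrullDim (Y : Set X) := by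
    rw [← range_reducedι Y, IsHomeomorph.topologicalKrullDim_eq _
      hemb.isEmbedding.toHomeomorph.isHomeomorph]
  -- The generic point of `Y` lies on no other component, so `W` is a proper closed subset of `Y`
  -- and the dimension drops.
  have hne : closure {t} ≠ (Set.univ : Set (reducedScheme Y)) := by
    intro h
    refine notMem_closure_compl_of_isGenericPoint hY (y := reducedι Y t) ?_ hxF.2
    have := hemb.closure_image_eq {t}
    rwa [h, Set.image_singleton, Set.image_univ, range_reducedι] at this
  have hge := topologicalKrullDim_add_one_le (isClosed_closure (s := {t})) hne
  rw [e₁, e₂] at hle hge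
  exact le_antisymm hge hle

lemma isPureDim_residualIntersection {k : Type u} [Field k] (f : X ⟶ Spec (.of k))
    [LocallyOfFiniteType f] [IsNoetherian X] {n : ℕ} (hn : 1 ≤ n) (hdim : IsPureDim X n)
    (hCM : IsCohenMacaulay X) (hY : (Y : Set X) ∈ irreducibleComponents X) :
    IsPureDim (residualIntersection Y).subscheme (n - 1) := by
  intro W hW
  have hemb := (residualIntersection Y).subschemeι.isClosedEmbedding
  have hrange : Set.range (residualIntersection Y).subschemeι =
      (Y : Set X) ∩ closure (Y : Set X)ᶜ := by
    rw [Scheme.IdealSheafData.range_subschemeι, coe_support_residualIntersection]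
  have key := topologicalKrullDim_add_one_eq f hCM hY
    (W := (residualIntersection Y).subschemeι '' W) ⟨⟨?_, ?_⟩, ?_⟩
  · rw [← IsHomeomorph.topologicalKrullDim_eq _
      (hemb.isEmbedding.homeomorphImage W).isHomeomorph] at key
    have h2 : topologicalKrullDim (Y : Set X) = n := hdim _ hY
    rw [h2] at key
    obtain ⟨m, rfl⟩ := Nat.exists_eq_add_of_le' hn
    rw [Nat.add_sub_cancel]
    generalize topologicalKrullDim W = d at key ⊢
    induction d using WithBot.recBotCoe with
    | bot => exact (WithBot.bot_ne_natCast _ key).elim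
    | coe a =>
      have h3 : a + 1 = (m : ℕ∞) + 1 := by exact_mod_cast key
      rw [ENat.add_left_injective_of_ne_top ENat.one_ne_top h3]
      rfl
  · exact hW.1.image _ (residualIntersection Y).subschemeι.continuous.continuousOn
  · rw [← hrange]; exact Set.image_subset_range _ _
  · rintro S ⟨hS, hSF⟩ hWS
    rw [← hrange] at hSF
    obtain ⟨S', rfl⟩ := Set.subset_range_iff_exists_image_eq.1 hSF
    have hS' : IsIrreducible S' := by
      rw [isIrreducible_iff_irreducibleSpace] at hS ⊢
      exact (hemb.isEmbedding.homeomorphImage S').irreducibleSpace_iff.2 hS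
    exact Set.image_mono (hW.2 hS' ((Set.image_subset_image_iff hemb.injective).1 hWS))

/-- If `Y` missed the closure of its complement it would be open and closed in a connected space. -/
lemma nonempty_residualIntersection [IsNoetherian X] [PreconnectedSpace X]
    (hY : (Y : Set X).Nonempty) (hne : (Y : Set X) ≠ Set.univ) :
    Nonempty (residualIntersection Y).subscheme := by
  obtain ⟨x, hx⟩ : ((Y : Set X) ∩ closure (Y : Set X)ᶜ).Nonempty := by
    by_contra h
    have hcl : IsClosed (Y : Set X)ᶜ := by
      refine isClosed_of_closure_subset fun x hx hxY ↦ h ⟨x, hxY, hx⟩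
    rcases isClopen_iff.1 (⟨Y.isClosed, isClosed_compl_iff.1 hcl⟩ : IsClopen (Y : Set X)) with h | h
    · exact hY.ne_empty h
    · exact hne h
  rw [← coe_support_residualIntersection, ← Scheme.IdealSheafData.range_subschemeι] at hx
  obtain ⟨z, -⟩ := hx
  exact ⟨z⟩

end Residual
end
end ACM

namespace ACM
noncomputable section

/-! ### Nowhere vanishing sections of `𝒪(m)` -/

section Ample
variable {k : Type u} [Field k] {N : ℕ} {Z : Scheme.{u}}

/-- Agreement of `X_l ^ m / u` on two charts `a`, `b`: here `q = X_b / X_a`, `r = X_l / X_b`, `b`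
stands for `u_b`, and `va`, `vb` are the inverses of `u_a`, `u_b`. -/
lemma mul_pow_mul_inverse_eq {R : Type*} [CommRing R] {m : ℕ} {b va vb q : R} (r : R)
    (h₁ : q ^ m * b * va = 1) (h₂ : b * vb = 1) : (r * q) ^ m * va = r ^ m * vb := by
  rw [mul_pow]
  linear_combination (r ^ m * vb) * h₁ - (r ^ m * q ^ m * va) * h₂

lemma appLE_ratioOn {D : Scheme.{u}} (g : D ⟶ Z) (f : Z ⟶ ProjSpace k N) (j l) {W : Z.Opens}
    (hW : W ≤ chart f j) {W' : D.Opens} (h : W' ≤ g ⁻¹ᵁ W) (h' : W' ≤ chart (g ≫ f) j) :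
    (g.appLE W W' h).hom (ratioOn f j l hW) = ratioOn (g ≫ f) j l h' := by
  rw [ratioOn_eq, ratioOn_eq]
  exact ConcreteCategory.congr_hom (Scheme.Hom.appLE_comp_appLE g f (coordOpen k N j) W W' hW h) _

lemma map_appLE_apply {D : Scheme.{u}} (g : D ⟶ Z) {U V : Z.Opens} {U' V' : D.Opens} (h : V ≤ U)
    (hU : U' ≤ g ⁻¹ᵁ U) (hV : V' ≤ g ⁻¹ᵁ V) (h' : V' ≤ U') (x : Γ(Z, U)) :
    (D.presheaf.map (homOfLE h').op).hom ((g.appLE U U' hU).hom x) =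
      (g.appLE V V' hV).hom ((Z.presheaf.map (homOfLE h).op).hom x) := by
  have h₁ := ConcreteCategory.congr_hom (g.appLE_map hU (homOfLE h').op) x
  have h₂ := ConcreteCategory.congr_hom (g.map_appLE hV (homOfLE h).op) x
  exact h₁.trans h₂.symm

lemma isUnit_of_forall_mem_basicOpen {U : Z.Opens} (a : Γ(Z, U)) (h : ∀ x ∈ U, x ∈ Z.basicOpen a) :
    IsUnit a := by
  exact Z.toRingedSpace.isUnit_of_isUnit_germ U a fun x hx ↦ (Z.mem_basicOpen a x hx).1 (h x hx)

lemma ratioOn_pow_mul_compatible (f : Z ⟶ ProjSpace k N) {m : ℕ} (u v : ∀ j, Γ(Z, chart f j))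
    (hv : ∀ j, u j * v j = 1)
    (rel : ∀ j l, ratioOn f j l (W := chart f j ⊓ chart f l) inf_le_left ^ m *
      (Z.presheaf.map (homOfLE inf_le_right).op).hom (u l) =
      (Z.presheaf.map (homOfLE inf_le_left).op).hom (u j)) (a b l : Fin (N + 1)) :
    (Z.presheaf.map (homOfLE (inf_le_left : chart f a ⊓ chart f b ≤ _)).op).hom
      (ratioOn f a l le_rfl ^ m * v a) = (Z.presheaf.map (homOfLE inf_le_right).op).hom
      (ratioOn f b l le_rfl ^ m * v b) := by
  have h1 := congrArg (Z.presheaf.map (homOfLE (inf_le_left : chart f a ⊓ chart f b ≤ _)).op).hom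
    (hv a)
  have h2 := congrArg (Z.presheaf.map (homOfLE (inf_le_right : chart f a ⊓ chart f b ≤ _)).op).hom
    (hv b)
  rw [map_mul, map_one, ← rel a b] at h1
  rw [map_mul, map_one] at h2
  rw [map_mul, map_mul, map_pow, map_pow, map_ratioOn, map_ratioOn,
    ratioOn_mul f a b l (inf_le_left : chart f a ⊓ chart f b ≤ _) inf_le_right]
  exact mul_pow_mul_inverse_eq _ h1 h2

/-- If a section `u` of `𝒪(m)` vanishes nowhere, then `X_l ^ m / u` is a global function. -/
lemma exists_glued_ratio (f : Z ⟶ ProjSpace k N) {m : ℕ} (u v : ∀ j, Γ(Z, chart f j))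
    (hv : ∀ j, u j * v j = 1)
    (rel : ∀ j l, ratioOn f j l (W := chart f j ⊓ chart f l) inf_le_left ^ m *
      (Z.presheaf.map (homOfLE inf_le_right).op).hom (u l) =
      (Z.presheaf.map (homOfLE inf_le_left).op).hom (u j)) (l : Fin (N + 1)) :
    ∃ r : Γ(Z, ⊤), ∀ j, (Z.presheaf.map (homOfLE (le_top : chart f j ≤ ⊤)).op).hom r =
      ratioOn f j l le_rfl ^ m * v j := by
  let U : ULift.{u} (Fin (N + 1)) → Z.Opens := fun j ↦ chart f j.down
  let sf : ∀ j, Γ(Z, U j) := fun j ↦ ratioOn f j.down l le_rfl ^ m * v j.down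
  have hcomp : TopCat.Presheaf.IsCompatible Z.sheaf.obj U sf := fun a b ↦
    ratioOn_pow_mul_compatible f u v hv rel a.down b.down l
  have hcov : (⊤ : Z.Opens) ≤ iSup U := fun x _ ↦ by
    obtain ⟨j, hj⟩ := exists_mem_chart f x
    exact Opens.mem_iSup.2 ⟨⟨j⟩, hj⟩
  obtain ⟨r, hr, -⟩ := Z.sheaf.existsUnique_gluing' U ⊤ (fun j ↦ homOfLE le_top) hcov sf hcomp
  exact ⟨r, fun j ↦ hr ⟨j⟩⟩

/-- If all global functions on `Z` are constant and a section of `𝒪(m)`, `m > 0`, vanishes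
nowhere on `Z`, then `Z` is contained in a chart. -/
lemma exists_chart_eq_top [Nonempty Z] (hF : IsField Γ(Z, ⊤)) (f : Z ⟶ ProjSpace k N) {m : ℕ}
    (hm : m ≠ 0) (u : ∀ j, Γ(Z, chart f j)) (hu : ∀ j, IsUnit (u j))
    (rel : ∀ j l, ratioOn f j l (W := chart f j ⊓ chart f l) inf_le_left ^ m *
      (Z.presheaf.map (homOfLE inf_le_right).op).hom (u l) =
      (Z.presheaf.map (homOfLE inf_le_left).op).hom (u j)) :
    ∃ l, chart f l = ⊤ := by
  obtain ⟨z⟩ := ‹Nonempty Z›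
  obtain ⟨l, hl⟩ := exists_mem_chart f z
  choose v hv using fun j ↦ (hu j).exists_right_inv
  obtain ⟨r, hr⟩ := exists_glued_ratio f u v hv rel l
  -- On the non-empty chart `l` the function `r` is the inverse of `u l`.
  have hr0 : r ≠ 0 := by
    intro h0
    have h := hr l
    rw [h0, map_zero, ratioOn_self, one_pow, one_mul] at h
    have h1 := hv l
    rw [← h, mul_zero] at h1
    have := eq_bot_of_subsingleton (subsingleton_of_zero_eq_one h1)
    rw [this] at hl
    exact hl
  obtain ⟨r', hr'⟩ := hF.mul_inv_cancel hr0
  refine ⟨l, eq_top_iff.2 fun x _ ↦ ?_⟩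
  obtain ⟨j, hj⟩ := exists_mem_chart f x
  -- Invertibility of `r` makes `X_l / X_j` a unit on chart `j`, because `m ≠ 0`; hence chart `j` is
  -- contained in chart `l`.
  refine basicOpen_ratioOn_le f j l (le_rfl : chart f j ≤ _) ?_
  have h1 := congrArg (Z.presheaf.map (homOfLE (le_top : chart f j ≤ ⊤)).op).hom hr'
  rw [map_mul, map_one, hr j, mul_assoc] at h1
  have hunit : IsUnit (ratioOn f j l (le_rfl : chart f j ≤ _)) :=
    (isUnit_pow_iff hm).1 (IsUnit.of_mul_eq_one _ h1)
  rw [Scheme.basicOpen_of_isUnit _ hunit]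
  exact hj

end Ample

/-! ### `F` meets every divisor of the linear system -/

section Meet
variable {k : Type u} [Field k] {N : ℕ}

/-- A closed subset of `T` that does not meet the zero scheme of a section of `𝒪(e)` has
dimension zero. -/
lemma topologicalKrullDim_le_zero_of_disjoint {T : Scheme.{u}} (f : T ⟶ ProjSpace k N)
    [IsClosedImmersion f] {e : ℤ} (he : 0 < e) {C : T.IdealSheafData} (hC : MemLinearSystem f e C)
    {W : Closeds T} (hW : IsIrreducible (W : Set T)) (hdisj : Disjoint (W : Set T) C.support) :
    topologicalKrullDim (W : Set T) ≤ 0 := by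
  have hI := isIntegral_reducedScheme hW
  obtain ⟨s, -, hsC⟩ := hC
  let g := reducedι W
  have hle (j) : chart (g ≫ f) j ≤ g ⁻¹ᵁ (⊤ ⊓ chart f j) := fun x hx ↦ ⟨trivial, hx⟩
  let u (j) : Γ(reducedScheme W, chart (g ≫ f) j) :=
    (g.appLE (⊤ ⊓ chart f j) _ (hle j)).hom (s.1 j : Γ(T, ⊤ ⊓ chart f j))
  have hF : IsField Γ(reducedScheme W, ⊤) :=
    isField_of_universallyClosed k ((g ≫ f) ≫ projToSpec k N)
  -- The pullback of the section to `W` is invertible because `W` avoids its zero scheme.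
  have hu (j) : IsUnit (u j) := by
    refine isUnit_of_forall_mem_basicOpen _ fun z hz ↦ ?_
    have hzW : g z ∉ C.support := fun h ↦
      Set.disjoint_left.1 hdisj (reducedι_mem W z) h
    obtain ⟨V, hzV, hV⟩ := exists_affineOpens_le (x := g z) (U := ⊤ ⊓ chart f j) (hle j hz)
    rw [Scheme.IdealSheafData.mem_support_iff_of_mem hzV, hsC j V hV,
      Scheme.zeroLocus_span, Scheme.zeroLocus_singleton, Set.mem_compl_iff, not_not] at hzW
    have h2 : g z ∈ T.basicOpen (s.1 j : Γ(T, ⊤ ⊓ chart f j)) := by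
      have := (Scheme.basicOpen_res T (s.1 j : Γ(T, ⊤ ⊓ chart f j)) (homOfLE hV).op).le hzW
      exact this.2
    exact (Scheme.basicOpen_appLE g _ _ (hle j) _).ge ⟨hz, h2⟩
  obtain ⟨l, hl⟩ := exists_chart_eq_top hF (g ≫ f) (m := e.toNat) (by omega) u hu (fun j l ↦ by
    have rel := s.2 j l
    rw [show (-e).toNat = 0 by omega, pow_zero, one_smul] at rel
    have hle' : chart (g ≫ f) j ⊓ chart (g ≫ f) l ≤ g ⁻¹ᵁ (⊤ ⊓ (chart f j ⊓ chart f l)) :=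
      fun x hx ↦ ⟨trivial, hx⟩
    have h := congrArg (g.appLE _ _ hle').hom
      (show (ratioOn f j l (inf_le_right.trans inf_le_left) ^ e.toNat *
        (T.presheaf.map (homOfLE (inf_le_inf_left ⊤ inf_le_right)).op).hom
          (s.1 l : Γ(T, ⊤ ⊓ chart f l)) : Γ(T, ⊤ ⊓ (chart f j ⊓ chart f l))) =
        (T.presheaf.map (homOfLE (inf_le_inf_left ⊤ inf_le_left)).op).hom
          (s.1 j : Γ(T, ⊤ ⊓ chart f j)) from rel)
    rw [map_mul, map_pow, appLE_ratioOn g f j l _ _ inf_le_left] at h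
    exact (congrArg (_ * ·) (map_appLE_apply g (inf_le_inf_left ⊤ inf_le_right) (hle l) hle'
      inf_le_right _)).trans (h.trans (map_appLE_apply g (inf_le_inf_left ⊤ inf_le_left) (hle j)
      hle' inf_le_left _).symm))
  -- Being closed in a single chart, `W` is affine; its coordinate ring is a field, so its dimension
  -- is zero.
  have haff : IsAffineOpen (⊤ : (reducedScheme W).Opens) := hl ▸ isAffineOpen_chart (g ≫ f) l
  rw [← range_reducedι W, ← IsHomeomorph.topologicalKrullDim_eq _
    g.isClosedEmbedding.isEmbedding.toHomeomorph.isHomeomorph,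
    ← IsHomeomorph.topologicalKrullDim_eq _ (Homeomorph.Set.univ (reducedScheme W)).isHomeomorph]
  refine (topologicalKrullDim_eq_ringKrullDim haff).trans_le ?_
  exact (ringKrullDim_eq_zero_of_isField hF).le

/-- The intersection of `Y` with the other components meets every divisor in `|𝒪_Y(e)|`. -/
lemma residualIntersection_inter_nonempty {X : Scheme.{u}} [IsNoetherian X] {Y : Closeds X}
    (i : X ⟶ ProjSpace k N) [IsClosedImmersion i] {n : ℕ} (hn : 1 ≤ n)
    (hF : Nonempty (residualIntersection Y).subscheme)
    (hdim : IsPureDim (residualIntersection Y).subscheme n) {e : ℤ} (he : 0 < e)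
    {C : (reducedScheme Y).IdealSheafData} (hC : MemLinearSystem (reducedι Y ≫ i) e C) :
    (((residualIntersection Y).support : Set X) ∩ Set.range (divisorι Y C)).Nonempty := by
  obtain ⟨z⟩ := hF
  let φ := (residualIntersection Y).subschemeι
  let W := irreducibleComponent z
  have hWd := hdim W (irreducibleComponent_mem_irreducibleComponents z)
  have hφ := φ.isClosedEmbedding
  have hι := (reducedι Y).isClosedEmbedding
  have hWF : φ '' W ⊆ (residualIntersection Y).support := by
    rw [← Scheme.IdealSheafData.range_subschemeι]
    exact Set.image_subset_range _ _
  have hWY : φ '' W ⊆ Set.range (reducedι Y) := by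
    rw [range_reducedι]
    rw [coe_support_residualIntersection] at hWF
    exact hWF.trans Set.inter_subset_left
  -- A component of `F` is viewed as a closed subset `S` of `Y`, where it can be compared with `C`.
  obtain ⟨S, hS⟩ := Set.subset_range_iff_exists_image_eq.1 hWY
  have hScl : IsClosed S := by
    rw [← Set.preimage_image_eq S hι.injective, hS]
    exact (hφ.isClosedMap _ isClosed_irreducibleComponent).preimage hι.continuous
  have hSirr : IsIrreducible S := by
    have : IsIrreducible (reducedι Y '' S) := by
      rw [hS]
      exact isIrreducible_irreducibleComponent.image _ hφ.continuous.continuousOn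
    rw [isIrreducible_iff_irreducibleSpace] at this ⊢
    exact (hι.isEmbedding.homeomorphImage S).irreducibleSpace_iff.2 this
  have hSd : topologicalKrullDim S = n := by
    rw [IsHomeomorph.topologicalKrullDim_eq _ (hι.isEmbedding.homeomorphImage S).isHomeomorph, hS,
      ← IsHomeomorph.topologicalKrullDim_eq _ (hφ.isEmbedding.homeomorphImage W).isHomeomorph, hWd]
  by_contra hempty
  have hdisj : Disjoint S C.support := Set.disjoint_left.2 fun t htS htC ↦ by
    refine hempty ⟨reducedι Y t, hWF (hS ▸ ⟨t, htS, rfl⟩), ?_⟩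
    rw [range_divisorι]
    exact ⟨t, htC, rfl⟩
  have := topologicalKrullDim_le_zero_of_disjoint (reducedι Y ≫ i) he hC (W := ⟨S, hScl⟩)
    hSirr hdisj
  have h2 : topologicalKrullDim S ≤ 0 := this
  rw [hSd] at h2
  have h3 : n ≤ 0 := by exact_mod_cast h2
  omega

end Meet
end
end ACM

theorem proposition5 {k : Type u} [Field k] [IsAlgClosed k] [CharZero k] (N n : ℕ) (hn : 2 ≤ n)
    (X : Scheme.{u}) (i : X ⟶ ACM.ProjSpace k N) [IsClosedImmersion i]
    (hdim : ACM.IsPureDim X n) (hCM : ACM.IsCohenMacaulay X) (hacm : ACM.HasACMVanishing i n)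
    (Y : Closeds X) (hY : (Y : Set X) ∈ irreducibleComponents X) (e : ℤ) (he : 0 < e) :
    (¬ ACM.HasMultiplicityOne Y →
      (∀ C : (ACM.reducedScheme Y).IdealSheafData,
        IsIntegral C.subscheme → ACM.MemLinearSystem (ACM.reducedι Y ≫ i) e C →
          ACM.nonLocallyFreeLocus Y C = Set.range (ACM.divisorι Y C)) ∧
      (∀ C₁ C₂ : (ACM.reducedScheme Y).IdealSheafData,
        IsIntegral C₁.subscheme → ACM.MemLinearSystem (ACM.reducedι Y ≫ i) e C₁ →
        IsIntegral C₂.subscheme → ACM.MemLinearSystem (ACM.reducedι Y ≫ i) e C₂ →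
          (Nonempty (ACM.idealModule (ACM.divisorι Y C₁) ≅ ACM.idealModule (ACM.divisorι Y C₂)) ↔
            C₁ = C₂))) ∧
    (ACM.HasMultiplicityOne Y → ¬ IsIntegral X →
      Nonempty (ACM.residualIntersection Y).subscheme ∧
      ACM.IsPureDim (ACM.residualIntersection Y).subscheme (n - 1) ∧
      ∀ C : (ACM.reducedScheme Y).IdealSheafData,
        IsIntegral C.subscheme → ACM.MemLinearSystem (ACM.reducedι Y ≫ i) e C →
          (((ACM.residualIntersection Y).support : Set X) ∩
            Set.range (ACM.divisorι Y C)).Nonempty ∧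
          ACM.nonLocallyFreeLocus Y C =
            ((ACM.residualIntersection Y).support : Set X) ∩ Set.range (ACM.divisorι Y C)) ∧
    (∀ C₁ C₂ : (ACM.reducedScheme Y).IdealSheafData,
      IsIntegral C₁.subscheme → ACM.MemLinearSystem (ACM.reducedι Y ≫ i) e C₁ →
      IsIntegral C₂.subscheme → ACM.MemLinearSystem (ACM.reducedι Y ≫ i) e C₂ →
        (Nonempty (ACM.idealModule (ACM.divisorι Y C₁) ≅ ACM.idealModule (ACM.divisorι Y C₂)) →
          ACM.nonLocallyFreeLocus Y C₁ = ACM.nonLocallyFreeLocus Y C₂) ∧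
        (¬ ACM.HasMultiplicityOne Y →
          ACM.nonLocallyFreeLocus Y C₁ = ACM.nonLocallyFreeLocus Y C₂ →
          Nonempty (ACM.idealModule (ACM.divisorι Y C₁) ≅
            ACM.idealModule (ACM.divisorι Y C₂)))) := by
  have : LocallyOfFiniteType (i ≫ ACM.projToSpec k N) := inferInstance
  have : IsLocallyNoetherian X := LocallyOfFiniteType.isLocallyNoetherian (i ≫ ACM.projToSpec k N)
  have : CompactSpace X := QuasiCompact.compactSpace_of_compactSpace (i ≫ ACM.projToSpec k N)
  have : IsNoetherian X := {}
  have hlocus (hm : ¬ ACM.HasMultiplicityOne Y) (C : (ACM.reducedScheme Y).IdealSheafData)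
      (hC : ACM.MemLinearSystem (ACM.reducedι Y ≫ i) e C) :
      ACM.nonLocallyFreeLocus Y C = Set.range (ACM.divisorι Y C) := by
    refine (ACM.nonLocallyFreeLocus_subset_range C).antisymm fun p hp ↦ ?_
    refine ⟨ACM.range_divisorι_subset C hp, fun hfree ↦ hm ?_⟩
    obtain ⟨V, hpV, hV⟩ := ACM.exists_ideal_eq_bot_of_isLocallyFreeAt i hY.1 he hC hp hfree
    exact ACM.hasMultiplicityOne_of_ideal_eq_bot hV (ACM.range_divisorι_subset C hp) hpV
  have heq (hm : ¬ ACM.HasMultiplicityOne Y) (C₁ C₂ : (ACM.reducedScheme Y).IdealSheafData)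
      (h₁ : IsIntegral C₁.subscheme) (hC₁ : ACM.MemLinearSystem (ACM.reducedι Y ≫ i) e C₁)
      (h₂ : IsIntegral C₂.subscheme) (hC₂ : ACM.MemLinearSystem (ACM.reducedι Y ≫ i) e C₂)
      (h : ACM.nonLocallyFreeLocus Y C₁ = ACM.nonLocallyFreeLocus Y C₂) : C₁ = C₂ := by
    rw [hlocus hm C₁ hC₁, hlocus hm C₂ hC₂] at h
    exact ACM.eq_of_range_divisorι_eq h
  refine ⟨fun hm ↦ ⟨fun C _ hC ↦ hlocus hm C hC, fun C₁ C₂ h₁ hC₁ h₂ hC₂ ↦ ⟨fun ⟨e⟩ ↦ ?_, ?_⟩⟩,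
    fun hm hX ↦ ?_, fun C₁ C₂ h₁ hC₁ h₂ hC₂ ↦ ⟨fun ⟨e⟩ ↦ ACM.nonLocallyFreeLocus_eq_of_iso e, ?_⟩⟩
  · exact heq hm C₁ C₂ h₁ hC₁ h₂ hC₂ (ACM.nonLocallyFreeLocus_eq_of_iso e)
  · rintro rfl
    exact ⟨Iso.refl _⟩
  · have : PreconnectedSpace X := ACM.preconnectedSpace_of_hasACMVanishing i hn hacm
    have hF := ACM.nonempty_residualIntersection hY.1.nonempty
      fun h ↦ hX (ACM.isIntegral_of_eq_univ hCM hY.1 hm h)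
    have hFdim := ACM.isPureDim_residualIntersection (i ≫ ACM.projToSpec k N)
      (by omega) hdim hCM hY
    -- Meeting `C` requires `F` to have positive dimension, that is `1 ≤ n - 1`, which follows from
    -- `n ≥ 2`.
    exact ⟨hF, hFdim, fun C _ hC ↦
      ⟨ACM.residualIntersection_inter_nonempty i (by omega) hF hFdim he hC,
        ACM.nonLocallyFreeLocus_eq i hCM hY.1 hm he hC⟩⟩
  · intro hm h
    obtain rfl := heq hm C₁ C₂ h₁ hC₁ h₂ hC₂ h
    exact ⟨Iso.refl _⟩
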